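/- Let $0<n<d$ be integers. Let $\mathcal A(d,n)$ be the set of affine $n$-planes in $\mathbb R^d$ with the metric $d_{\mathcal A}(V,W)=\|\pi_{V_0}-\pi_{W_0}\|_{op}+|a-b|$, where $V=V_0+a$, $W=W_0+b$ with $V_0,W_0$ linear subspaces, $a\in V_0^\perp$, $b\in W_0^\perp$, and $\pi_{V_0}$ denotes the orthogonal projection onto $V_0$. A subset of a metric space is $\delta$-separated if its distinct points are at distance at least $\delta$. For $0<\delta<1$, let $|A|_\delta$ be the minimal number of (closed) $\delta$-balls needed to cover $A$; a bounded set $P\subset\mathbb R^d$ is a $(\delta,t,C_F)$-set if $|P\cap B|_\delta\le C_F\,|P|_\delta\, r^t$ for every $\delta<r<1$ and every closed ball $B\subset\mathbb R^d$ of radius $r$. For $r>0$, write $V(r)=\{x\in\mathbb R^d:\operatorname{dist}(x,V)\le r\}$ and $\mathcal I_r(P,\mathcal V)=\{(p,V)\in P\times\mathcal V: p\in V(r)\}$. **Theorem.** Let $d\ge 2$, $C\ge 1$, $\varepsilon>0$ and $t\in\mathbb R$. There is a constant $K>0$, depending only on $C,d,\varepsilon,t$, such that the following holds. Let $0<n<d$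 be an integer with $d-n<t\le d$, let $C_F\ge 1$ and $0<\delta<1$, let $\mathcal V\subset\mathcal A(d,n)$ be a $\delta$-separated set, and let $P$ be a $\delta$-separated $(\delta,t,C_F)$-set contained in the closed unit ball $B(1)\subset\mathbb R^d$. Then $$|\mathcal I_{C\delta}(P,\mathcal V)|\le K\,\delta^{-\varepsilon}\, C_F\,|P|\,|\mathcal V|^{\frac{n}{d+n-t}}\;\delta^{\frac{n(t+1-d)(d-n)}{d+n-t}},$$ where $|\cdot|$ denotes cardinality (if $\mathcal V$ is infinite, $|\mathcal V|=\infty$, and $0\cdot\infty=0$). -/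

import Mathlib

open scoped NNReal ENNReal

noncomputable section

/-- The affine Grassmannian `𝒜(d,n)`: the (nonempty) affine `n`-planes in `ℝ^d`. -/
structure AffGrass (d n : ℕ) where
  plane : AffineSubspace ℝ (EuclideanSpace ℝ (Fin d))
  nonempty : (plane : Set (EuclideanSpace ℝ (Fin d))).Nonempty
  finrank_direction : Module.finrank ℝ plane.direction = n

namespace AffGrass

variable {d n : ℕ}

instance (V : AffGrass d n) : Nonempty V.plane := V.nonempty.to_subtype

/-- The orthogonal projection `π_{V₀}` onto the direction `V₀` of `V`, as an operator on `ℝ^d`. -/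
def dirProj (V : AffGrass d n) : EuclideanSpace ℝ (Fin d) →L[ℝ] EuclideanSpace ℝ (Fin d) :=
  V.plane.direction.starProjection

/-- The unique vector `a ∈ V₀ᗮ` with `V = V₀ + a`, that is, the orthogonal projection of the
origin to `V`. -/
def foot (V : AffGrass d n) : EuclideanSpace ℝ (Fin d) :=
  (EuclideanGeometry.orthogonalProjection V.plane (0 : EuclideanSpace ℝ (Fin d)) :
    EuclideanSpace ℝ (Fin d))

theorem foot_mem (V : AffGrass d n) : V.foot ∈ V.plane :=
  EuclideanGeometry.orthogonalProjection_mem _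

theorem foot_mem_orthogonal (V : AffGrass d n) : V.foot ∈ V.plane.directionᗮ := by
  have h := EuclideanGeometry.orthogonalProjection_vsub_mem_direction_orthogonal V.plane
    (0 : EuclideanSpace ℝ (Fin d))
  simpa [foot] using h

theorem ext_of_dirProj_foot {V W : AffGrass d n} (h₁ : V.dirProj = W.dirProj)
    (h₂ : V.foot = W.foot) : V = W := by
  have hd : V.plane.direction = W.plane.direction := Submodule.starProjection_inj.1 h₁
  have hp : V.plane = W.plane :=
    AffineSubspace.ext_of_direction_eq hd ⟨V.foot, V.foot_mem, h₂ ▸ W.foot_mem⟩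
  cases V
  cases W
  cases hp
  rfl

/-- The metric `d_𝒜(V,W) = ‖π_{V₀} - π_{W₀}‖_{op} + |a - b|` on `𝒜(d,n)`, where `V = V₀ + a` and
`W = W₀ + b` with `a ∈ V₀ᗮ`, `b ∈ W₀ᗮ`. -/
instance : MetricSpace (AffGrass d n) where
  dist V W := ‖V.dirProj - W.dirProj‖ + ‖V.foot - W.foot‖
  dist_self V := by simp
  dist_comm V W := by
    rw [norm_sub_rev V.dirProj, norm_sub_rev V.foot]
  dist_triangle U V W := by
    have h₁ := norm_sub_le_norm_sub_add_norm_sub U.dirProj V.dirProj W.dirProj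
    have h₂ := norm_sub_le_norm_sub_add_norm_sub U.foot V.foot W.foot
    linarith
  eq_of_dist_eq_zero {V W} h := by
    have h₁ := norm_nonneg (V.dirProj - W.dirProj)
    have h₂ := norm_nonneg (V.foot - W.foot)
    have h' : ‖V.dirProj - W.dirProj‖ + ‖V.foot - W.foot‖ = 0 := h
    exact ext_of_dirProj_foot (sub_eq_zero.1 (norm_eq_zero.1 (by linarith)))
      (sub_eq_zero.1 (norm_eq_zero.1 (by linarith)))

end AffGrass

/-- Distinct points of `A` are at distance at least `δ`. -/
def IsDeltaSeparated {X : Type*} [MetricSpace X] (δ : ℝ) (A : Set X) : Prop :=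
  A.Pairwise fun x y => δ ≤ dist x y

/-- The `δ`-covering number `|A|_δ`: the minimal number of closed `δ`-balls needed to cover `A`. -/
def deltaCov {X : Type*} [MetricSpace X] (δ : ℝ) (A : Set X) : ℝ≥0∞ :=
  (Metric.externalCoveringNumber δ.toNNReal A : ℝ≥0∞)

/-- `(δ,s,C)`-sets: bounded sets `P` with `|P ∩ B|_δ ≤ C · |P|_δ · r^s` for all `δ < r < 1` and all
(closed) balls `B` of radius `r`. -/
def IsDeltaSet {X : Type*} [MetricSpace X] (δ s C : ℝ) (P : Set X) : Prop :=
  Bornology.IsBounded P ∧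
    ∀ r : ℝ, δ < r → r < 1 → ∀ x : X,
      deltaCov δ (P ∩ Metric.closedBall x r) ≤
        ENNReal.ofReal C * deltaCov δ P * ENNReal.ofReal (r ^ s)

/-- The incidences `ℐ_r(P,𝒱) = {(p,V) ∈ P × 𝒱 : p ∈ V(r)}`, where `V(r)` is the closed
`r`-neighbourhood of `V`. -/
def incidences {d n : ℕ} (r : ℝ) (P : Set (EuclideanSpace ℝ (Fin d))) (𝒱 : Set (AffGrass d n)) :
    Set (EuclideanSpace ℝ (Fin d) × AffGrass d n) :=
  {x | x.1 ∈ P ∧ x.2 ∈ 𝒱 ∧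
    x.1 ∈ Metric.cthickening r (x.2.plane : Set (EuclideanSpace ℝ (Fin d)))}

end

/-! The proof is a high-low argument in which Gaussian averages and dilation differences replace
Fourier analysis. Put `m = d - n`. Every `n`-plane is a graph, with slopes at most `1`, over some
choice of `n` coordinates (`exists_graph_of_finrank_eq`), so finitely many charts reduce the problem
to graphs of affine maps from `ℝⁿ` to `ℝᵐ`, whose parameters `θ` fill a space of dimension `(n + 1)
* m`. In a chart the metric on planes is at most a constant times the distance of parameters
(`IsGraphOf.dist_le`), so the parameters remain separated at scale `δ`.

Let `u θ τ` be the sum over the points of Gaussian bumps of variance `τ` around the graph of `θ`.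
The number of points near a plane is at most a constant times `δ ^ m * u θ (δ ^ 2)`, for every `θ`
close to the parameter of the plane. Let `F` be of size `C_F * |P|`.

Low part: at scale `s` the ball condition gives `u θ (s ^ 2) ≲ F * s ^ (t - d)` pointwise
(`exists_sum_graphBump_le`).

High part: the integral over all graphs of a product of two bumps is explicit. It is the heat kernel
`w ^ (-m/2) * exp (-y / (2 * w))`, where `y` is the squared vertical distance of the two points and
`w` is the sum of both variances and the squared horizontal distance (`integral_graphBump_mul`).
Applying `dilDiff K` in the variance gains as much as `K` derivatives in `w`, so the kernel of the
scale-`s` difference is at most `s ^ (-m) * (1 + |z - z'| / s) ^ (-(m + 2 * K))`. This is integrable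
on `ℝ^d` once `2 * K > n`, and the squared `L²` norm of the difference is then `≲ F ^ 2 * s ^ (t -
m)`.

The value at scale `δ` is recovered from the differences at the `L` scales below `s₀ = 2 ^ L * δ`
and from the low part (`abs_le_of_dilDiff_le`). Integration over disjoint balls around the
parameters bounds the incidences by `F * δ ^ m * (|𝒱| * s₀ ^ (t - d) + s₀ ^ n * δ ^ (-(n + 1) *
m))`, up to powers of `L + 1`. The two terms balance at `s₀ ^ (d + n - t) = |𝒱| * δ ^ ((n + 1) *
m)`, which gives the stated exponents; the powers of `L + 1` are absorbed in `δ ^ (-ε)`. -/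

open MeasureTheory Real

/-! ### Gaussian integrals over affine functions -/

/-- The (unnormalised) one-dimensional Gaussian kernel of variance `τ`. -/
noncomputable def gaussKer (τ r : ℝ) : ℝ := (√τ)⁻¹ * exp (-r ^ 2 / (2 * τ))

lemma gaussKer_nonneg (τ r : ℝ) : 0 ≤ gaussKer τ r := by unfold gaussKer; positivity

@[fun_prop]
lemma continuous_gaussKer (τ : ℝ) : Continuous (gaussKer τ) := by
  unfold gaussKer; fun_prop

lemma lintegral_exp_neg_mul_sub_sq {α : ℝ} (hα : 0 < α) (β : ℝ) :
    ∫⁻ x : ℝ, ENNReal.ofReal (exp (-α * (x - β) ^ 2)) = ENNReal.ofReal √(π / α) := by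
  rw [lintegral_sub_right_eq_self (fun x : ℝ => ENNReal.ofReal (exp (-α * x ^ 2))) β,
    ← integral_gaussian, ofReal_integral_eq_lintegral_ofReal (integrable_exp_neg_mul_sq hα)]
  exact Filter.Eventually.of_forall fun x => (exp_pos _).le

/-- Completing the square in `a`: averaging over a Gaussian slope adds `c ^ 2` to the variance. -/
lemma lintegral_gaussKer_mul_exp {τ : ℝ} (hτ : 0 < τ) (c y : ℝ) :
    ∫⁻ a : ℝ, ENNReal.ofReal (gaussKer τ (y - c * a) * exp (-a ^ 2 / 2)) =
      ENNReal.ofReal (√(2 * π) * gaussKer (τ + c ^ 2) y) := by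
  have hs : 0 < τ + c ^ 2 := by positivity
  have hα : 0 < (τ + c ^ 2) / (2 * τ) := by positivity
  have key : ∀ a : ℝ, ENNReal.ofReal (gaussKer τ (y - c * a) * exp (-a ^ 2 / 2)) =
      ENNReal.ofReal ((√τ)⁻¹ * exp (-y ^ 2 / (2 * (τ + c ^ 2)))) *
        ENNReal.ofReal (exp (-((τ + c ^ 2) / (2 * τ)) * (a - c * y / (τ + c ^ 2)) ^ 2)) := by
    intro a
    rw [← ENNReal.ofReal_mul (by positivity)]
    unfold gaussKer
    rw [mul_assoc, mul_assoc, ← exp_add, ← exp_add]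
    congr 3
    field_simp
    ring
  simp_rw [key]
  rw [lintegral_const_mul _ (by fun_prop), lintegral_exp_neg_mul_sub_sq hα,
    ← ENNReal.ofReal_mul (by positivity)]
  congr 1
  unfold gaussKer
  have : π / ((τ + c ^ 2) / (2 * τ)) = 2 * π * τ / (τ + c ^ 2) := by field_simp
  rw [this, sqrt_div (by positivity), sqrt_mul (by positivity)]
  have := (sqrt_pos.2 hτ).ne'
  field_simp

lemma lintegral_gaussKer_mul_gaussKer {τ τ' : ℝ} (hτ : 0 < τ) (hτ' : 0 < τ') (y y' : ℝ) :
    ∫⁻ b : ℝ, ENNReal.ofReal (gaussKer τ (y - b) * gaussKer τ' (y' - b)) =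
      ENNReal.ofReal (√(2 * π) * gaussKer (τ + τ') (y - y')) := by
  have hs : 0 < τ + τ' := by positivity
  have hα : 0 < (τ + τ') / (2 * τ * τ') := by positivity
  have key : ∀ b : ℝ, ENNReal.ofReal (gaussKer τ (y - b) * gaussKer τ' (y' - b)) =
      ENNReal.ofReal ((√τ)⁻¹ * (√τ')⁻¹ * exp (-(y - y') ^ 2 / (2 * (τ + τ')))) *
        ENNReal.ofReal (exp (-((τ + τ') / (2 * τ * τ')) *
          (b - (τ' * y + τ * y') / (τ + τ')) ^ 2)) := by
    intro b
    rw [← ENNReal.ofReal_mul (by positivity)]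
    unfold gaussKer
    rw [mul_mul_mul_comm, mul_assoc _ (exp _), ← exp_add, ← exp_add]
    congr 3
    field_simp
    ring
  simp_rw [key]
  rw [lintegral_const_mul _ (by fun_prop), lintegral_exp_neg_mul_sub_sq hα,
    ← ENNReal.ofReal_mul (by positivity)]
  congr 1
  unfold gaussKer
  have : π / ((τ + τ') / (2 * τ * τ')) = 2 * π * τ * τ' / (τ + τ') := by field_simp
  rw [this, sqrt_div (by positivity), sqrt_mul (by positivity), sqrt_mul (by positivity)]
  have := (sqrt_pos.2 hτ).ne'
  have := (sqrt_pos.2 hτ').ne'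
  field_simp

/-- The slopes are integrated one at a time, each adding its `z j ^ 2` to the variance; hence the
induction must leave `σ` free. -/
lemma lintegral_gaussKer_linear {n : ℕ} : ∀ {σ : ℝ}, 0 < σ → ∀ (z : Fin n → ℝ) (y : ℝ),
    ∫⁻ a : Fin n → ℝ, ENNReal.ofReal
        (gaussKer σ (y - ∑ j, a j * z j) * ∏ j, exp (-a j ^ 2 / 2)) =
      ENNReal.ofReal (√(2 * π) ^ n * gaussKer (σ + ∑ j, z j ^ 2) y) := by
  induction n with
  | zero =>
    intro σ hσ z y
    simp [lintegral_unique, volume_pi]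
  | succ n ih =>
    intro σ hσ z y
    have hz : 0 ≤ √(2 * π) := by positivity
    rw [← (volume_preserving_piFinSuccAbove (fun _ : Fin (n + 1) => ℝ) 0).symm.lintegral_comp_emb
      (MeasurableEquiv.measurableEmbedding _)]
    rw [Measure.volume_eq_prod, lintegral_prod_symm']
    · simp only [MeasurableEquiv.piFinSuccAbove_symm_apply, Fin.insertNthEquiv,
        Equiv.coe_fn_mk, Fin.insertNth_zero', Fin.sum_univ_succ, Fin.prod_univ_succ, Fin.cons_zero,
        Fin.cons_succ]
      have key : ∀ a : Fin n → ℝ, ∫⁻ x : ℝ, ENNReal.ofReal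
          (gaussKer σ (y - (x * z 0 + ∑ j, a j * z j.succ)) *
            (exp (-x ^ 2 / 2) * ∏ j, exp (-a j ^ 2 / 2))) =
          ENNReal.ofReal √(2 * π) * ENNReal.ofReal
            (gaussKer (σ + z 0 ^ 2) (y - ∑ j, a j * z j.succ) * ∏ j, exp (-a j ^ 2 / 2)) := by
        intro a
        have : ∀ x : ℝ, ENNReal.ofReal
          (gaussKer σ (y - (x * z 0 + ∑ j, a j * z j.succ)) *
            (exp (-x ^ 2 / 2) * ∏ j, exp (-a j ^ 2 / 2))) =
          ENNReal.ofReal (gaussKer σ ((y - ∑ j, a j * z j.succ) - z 0 * x) * exp (-x ^ 2 / 2)) *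
            ENNReal.ofReal (∏ j, exp (-a j ^ 2 / 2)) := by
          intro x
          rw [← ENNReal.ofReal_mul (mul_nonneg (gaussKer_nonneg _ _) (exp_pos _).le), mul_assoc]
          congr 3
          ring
        simp_rw [this]
        rw [lintegral_mul_const _ (by fun_prop), lintegral_gaussKer_mul_exp hσ,
          ENNReal.ofReal_mul hz, mul_assoc, ENNReal.ofReal_mul (gaussKer_nonneg _ _)]
      simp_rw [key]
      rw [lintegral_const_mul _ (by fun_prop), ih (by positivity), ← ENNReal.ofReal_mul hz]
      congr 1
      rw [pow_succ]
      ring_nf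
    · have hm : Measurable fun a : Fin (n + 1) → ℝ => ENNReal.ofReal
          (gaussKer σ (y - ∑ j, a j * z j) * ∏ j, exp (-a j ^ 2 / 2)) := by fun_prop
      exact hm.comp (MeasurableEquiv.measurable _)

/-- Integrating the product of two Gaussian kernels over the affine functions `x ↦ a · x + b`. -/
lemma lintegral_gaussKer_affine {n : ℕ} {τ τ' : ℝ} (hτ : 0 < τ) (hτ' : 0 < τ')
    (x x' : Fin n → ℝ) (y y' : ℝ) :
    ∫⁻ q : (Fin n → ℝ) × ℝ, ENNReal.ofReal
        (gaussKer τ (y - ∑ j, q.1 j * x j - q.2) * gaussKer τ' (y' - ∑ j, q.1 j * x' j - q.2) *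
          ∏ j, exp (-q.1 j ^ 2 / 2)) =
      ENNReal.ofReal (√(2 * π) ^ (n + 1) *
        gaussKer (τ + τ' + ∑ j, (x j - x' j) ^ 2) (y - y')) := by
  have hz : 0 ≤ √(2 * π) := by positivity
  rw [Measure.volume_eq_prod, lintegral_prod _ (by fun_prop)]
  have key : ∀ a : Fin n → ℝ, ∫⁻ b : ℝ, ENNReal.ofReal
      (gaussKer τ (y - ∑ j, a j * x j - b) * gaussKer τ' (y' - ∑ j, a j * x' j - b) *
          ∏ j, exp (-a j ^ 2 / 2)) =
      ENNReal.ofReal √(2 * π) * ENNReal.ofReal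
        (gaussKer (τ + τ') ((y - y') - ∑ j, a j * (x j - x' j)) * ∏ j, exp (-a j ^ 2 / 2)) := by
    intro a
    simp_rw [ENNReal.ofReal_mul (mul_nonneg (gaussKer_nonneg _ _) (gaussKer_nonneg _ _))]
    rw [lintegral_mul_const _ (by fun_prop), lintegral_gaussKer_mul_gaussKer hτ hτ',
      ENNReal.ofReal_mul hz, mul_assoc, ENNReal.ofReal_mul (gaussKer_nonneg _ _)]
    simp_rw [mul_sub, Finset.sum_sub_distrib]
    congr 4
    ring
  simp_rw [key]
  rw [lintegral_const_mul _ (by fun_prop), lintegral_gaussKer_linear (by positivity),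
    ← ENNReal.ofReal_mul hz]
  congr 1
  rw [pow_succ]
  ring

/-! ### Dilation differences -/

/-- The difference operator with factors `1 - 4^{-a} S`, `a < k`, where `S f τ = f (4 τ)`. It
annihilates the polynomials of degree less than `k`. -/
noncomputable def dilDiff : ℕ → (ℝ → ℝ) → ℝ → ℝ
  | 0, f, τ => f τ
  | k + 1, f, τ => dilDiff k f τ - ((4 : ℝ) ^ k)⁻¹ * dilDiff k f (4 * τ)

lemma dilDiff_succ (k : ℕ) (f : ℝ → ℝ) (τ : ℝ) :
    dilDiff (k + 1) f τ = dilDiff k f τ - ((4 : ℝ) ^ k)⁻¹ * dilDiff k f (4 * τ) := rfl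

/-- The coefficients depend on `k` only, so that the operator commutes with sums over points and
with integrals over graphs. -/
lemma exists_dilDiff_eq_sum (k : ℕ) :
    ∃ c : ℕ → ℝ, ∀ f τ, dilDiff k f τ = ∑ i ∈ Finset.range (k + 1), c i * f (4 ^ i * τ) := by
  induction k with
  | zero => exact ⟨fun _ => 1, fun f τ => by simp [dilDiff]⟩
  | succ k ih =>
    obtain ⟨c, hc⟩ := ih
    refine ⟨fun i => (if i < k + 1 then c i else 0) -
      (if i = 0 then 0 else ((4 : ℝ) ^ k)⁻¹ * c (i - 1)), fun f τ => ?_⟩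
    rw [dilDiff_succ, hc, hc]
    simp_rw [sub_mul, Finset.sum_sub_distrib]
    congr 1
    · rw [Finset.sum_range_succ _ (k + 1)]
      simp only [lt_irrefl, if_false, zero_mul, add_zero]
      refine Finset.sum_congr rfl fun i hi => ?_
      rw [if_pos (Finset.mem_range.1 hi)]
    · rw [Finset.sum_range_succ' _ (k + 1), Finset.mul_sum]
      simp only [Nat.add_eq_zero_iff, one_ne_zero, and_false, if_false, Nat.add_sub_cancel,
        if_true, zero_mul, add_zero]
      refine Finset.sum_congr rfl fun i _ => ?_
      rw [pow_succ, mul_assoc, mul_assoc]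

/-- The factor `a = 0` is `1 - S`, which kills the value at the fixed point `0` of the dilation. -/
lemma dilDiff_succ_zero (k : ℕ) (f : ℝ → ℝ) : dilDiff (k + 1) f 0 = 0 := by
  induction k with
  | zero => simp [dilDiff]
  | succ k ih => rw [dilDiff_succ, mul_zero, ih]; simp

/-- Differentiating past `S` produces a factor `4`, which turns `1 - 4^{-a} S` into `1 - 4^{-(a-1)}
S`. The factors with `a ≥ 1` thus become `dilDiff k`, and the one with `a = 0` becomes `1 - 4 S`. -/
lemma hasDerivAt_dilDiff_succ (k : ℕ) {f f' : ℝ → ℝ} (hf : ∀ r, 0 ≤ r → HasDerivAt f (f' r) r) :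
    ∀ {τ : ℝ}, 0 ≤ τ → HasDerivAt (dilDiff (k + 1) f)
      (dilDiff k f' τ - 4 * dilDiff k f' (4 * τ)) τ := by
  have hsc : ∀ (g : ℝ → ℝ) (g' τ : ℝ), HasDerivAt g g' (4 * τ) →
      HasDerivAt (fun x => g (4 * x)) (4 * g') τ := fun g g' τ h => by
    have h4 : HasDerivAt (fun x : ℝ => 4 * x) 4 τ := by
      simpa using (hasDerivAt_id τ).const_mul (4 : ℝ)
    have := h.comp τ h4
    rwa [mul_comm] at this
  induction k with
  | zero =>
    intro τ hτ
    have := (hf τ hτ).sub (hsc f _ τ (hf (4 * τ) (by positivity)))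
    have e : dilDiff (0 + 1) f = f - fun x => f (4 * x) := by
      funext x
      simp [dilDiff]
    rw [e]
    exact this
  | succ k ih =>
    intro τ hτ
    have := (ih hτ).sub ((hsc _ _ τ (ih (τ := 4 * τ) (by positivity))).const_mul
      ((4 : ℝ) ^ (k + 1))⁻¹)
    refine this.congr_deriv ?_
    rw [dilDiff_succ, dilDiff_succ]
    field_simp
    ring

/-- A function whose `k`-th derivative is bounded has small `k`-th dilation difference. -/
lemma exists_abs_dilDiff_le (k : ℕ) : ∃ C : ℝ, 0 ≤ C ∧ ∀ (F : ℕ → ℝ → ℝ) (B : ℝ),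
    (∀ i r, 0 ≤ r → HasDerivAt (F i) (F (i + 1) r) r) → (∀ r, 0 ≤ r → |F k r| ≤ B) →
    ∀ τ, 0 ≤ τ → |dilDiff k (F 0) τ| ≤ C * B * τ ^ k := by
  induction k with
  | zero => exact ⟨1, zero_le_one, fun F B _ hB τ hτ => by simpa [dilDiff] using hB τ hτ⟩
  | succ k ih =>
    obtain ⟨C, hC, h⟩ := ih
    refine ⟨C * (1 + 4 * 4 ^ k), by positivity, fun F B hF hB τ hτ => ?_⟩
    have hB0 : 0 ≤ B := (abs_nonneg _).trans (hB 0 le_rfl)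
    have hD := h (fun i => F (i + 1)) B (fun i r hr => hF (i + 1) r hr) hB
    -- Mean value inequality from `0`, where the difference vanishes: each order of differencing
    -- trades one derivative for one power of `τ`.
    have key := (convex_Icc (0 : ℝ) τ).norm_image_sub_le_of_norm_hasDerivWithin_le
      (f := dilDiff (k + 1) (F 0)) (C := C * (1 + 4 * 4 ^ k) * B * τ ^ k)
      (fun x hx => (hasDerivAt_dilDiff_succ k (hF 0) hx.1).hasDerivWithinAt)
      (fun x hx => by
        have h1 := hD x hx.1
        have h2 := hD (4 * x) (by linarith [hx.1])
        have h3 : x ^ k ≤ τ ^ k := pow_le_pow_left₀ hx.1 hx.2 k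
        rw [mul_pow] at h2
        rw [Real.norm_eq_abs]
        refine (abs_sub _ _).trans ?_
        rw [abs_mul, abs_of_pos (by norm_num : (0 : ℝ) < 4)]
        have h4 : C * B * x ^ k ≤ C * B * τ ^ k := by gcongr
        have h5 : C * B * (4 ^ k * x ^ k) ≤ C * B * (4 ^ k * τ ^ k) := by gcongr
        simp only [zero_add] at h1 h2
        linarith)
      (Set.left_mem_Icc.2 hτ) (Set.right_mem_Icc.2 hτ)
    rw [dilDiff_succ_zero, sub_zero, sub_zero, Real.norm_eq_abs, Real.norm_eq_abs,
      abs_of_nonneg hτ] at key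
    rw [pow_succ]
    linarith

/-! ### Derivatives of the heat kernel -/

lemma exists_one_add_rpow_le_exp (a : ℝ) {c : ℝ} (hc : 0 < c) :
    ∃ C : ℝ, 0 < C ∧ ∀ x : ℝ, 0 ≤ x → (1 + x) ^ a ≤ C * exp (c * x) := by
  obtain ⟨N, hN⟩ := exists_nat_ge (max a (max 1 c⁻¹))
  have h1 : (1 : ℝ) ≤ N := (le_max_left _ _).trans ((le_max_right _ _).trans hN)
  have h2 : c⁻¹ ≤ N := (le_max_right _ _).trans ((le_max_right _ _).trans hN)
  have hN0 : (0 : ℝ) < N := by linarith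
  have hcN : 1 ≤ N * c := by
    have := mul_le_mul_of_nonneg_right h2 hc.le
    rwa [inv_mul_cancel₀ hc.ne'] at this
  refine ⟨(N * N) ^ N, by positivity, fun x hx => ?_⟩
  calc (1 + x) ^ a ≤ (1 + x) ^ (N : ℝ) :=
        rpow_le_rpow_of_exponent_le (by linarith) ((le_max_left _ _).trans hN)
    _ = (1 + x) ^ N := rpow_natCast _ _
    _ ≤ ((N * N) * (c * x / N + 1)) ^ N := by
        gcongr
        have : (N * N : ℝ) * (c * x / N + 1) = (N * c) * x + N * N := by field_simp
        rw [this]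
        nlinarith
    _ ≤ ((N * N) * exp (c * x / N)) ^ N := by
        gcongr
        exact add_one_le_exp _
    _ = (N * N) ^ N * exp (c * x) := by
        rw [mul_pow, ← exp_nat_mul]
        congr 2
        field_simp

/-- Iterated derivatives in `w` of `y ^ b * w ^ (-a) * exp (-y / (2 * w))`. -/
noncomputable def heatDeriv : ℕ → ℝ → ℕ → ℝ → ℝ → ℝ
  | 0, a, b, y, w => y ^ b * w ^ (-a) * exp (-y / (2 * w))
  | k + 1, a, b, y, w => -a * heatDeriv k (a + 1) b y w + 1 / 2 * heatDeriv k (a + 2) (b + 1) y w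

lemma hasDerivAt_heatDeriv (k : ℕ) (y : ℝ) {w : ℝ} (hw : 0 < w) : ∀ (a : ℝ) (b : ℕ),
    HasDerivAt (heatDeriv k a b y) (heatDeriv (k + 1) a b y w) w := by
  induction k with
  | zero =>
    intro a b
    have h1 : HasDerivAt (fun w : ℝ => w ^ (-a)) (-a * w ^ (-a - 1)) w :=
      Real.hasDerivAt_rpow_const (Or.inl hw.ne')
    have h2 : HasDerivAt (fun w : ℝ => exp (-y / (2 * w)))
        (exp (-y / (2 * w)) * (y / (2 * w ^ 2))) w := by
      have h3 : HasDerivAt (fun w : ℝ => -y / (2 * w)) (y / (2 * w ^ 2)) w := by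
        have := (hasDerivAt_const w (-y)).fun_div ((hasDerivAt_id w).const_mul 2)
          (by simpa using hw.ne')
        refine this.congr_deriv ?_
        simp
        field_simp
      exact h3.exp
    have := (h1.const_mul (y ^ b)).mul h2
    refine this.congr_deriv ?_
    simp only [heatDeriv]
    rw [show -(a + 1) = -a - 1 by ring, show -(a + 2) = -a - (2 : ℕ) by push_cast; ring,
      rpow_sub_natCast hw.ne', rpow_sub_one hw.ne']
    field_simp
    ring
  | succ k ih =>
    intro a b
    exact ((ih (a + 1) b).const_mul (-a)).add ((ih (a + 2) (b + 1)).const_mul (1 / 2))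

/-- By homogeneity of degree `b - a - k` in `(y, w)` only the ratio `y / w` matters, and the
exponential absorbs all its powers. The bound thus stays uniform as `w` tends to `0` with `y` fixed,
which covers points lying above one another. -/
lemma exists_abs_heatDeriv_le (k : ℕ) : ∀ (a : ℝ) (b : ℕ), ∃ C : ℝ, 0 ≤ C ∧ ∀ y w : ℝ, 0 ≤ y →
    0 < w → |heatDeriv k a b y w| ≤ C * (w + y) ^ (-(a - b + k)) := by
  induction k with
  | zero =>
    intro a b
    obtain ⟨C, hC, h⟩ := exists_one_add_rpow_le_exp a (c := 1 / 2) (by norm_num)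
    refine ⟨C, hC.le, fun y w hy hw => ?_⟩
    have hx : 0 ≤ y / w := by positivity
    have h1 := h _ hx
    have hs : 0 < 1 + y / w := by positivity
    simp only [heatDeriv]
    rw [abs_of_nonneg (by positivity)]
    have e1 : w + y = w * (1 + y / w) := by field_simp
    rw [e1, mul_rpow hw.le hs.le]
    have e2 : y ^ b = w ^ b * (y / w) ^ b := by rw [← mul_pow]; congr 1; field_simp
    have e3 : w ^ b * w ^ (-a) = w ^ (-(a - b + (0 : ℕ))) := by
      rw [← rpow_natCast, ← rpow_add hw]; congr 1; push_cast; ring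
    have e4 : (y / w) ^ b * exp (-y / (2 * w)) ≤ C * (1 + y / w) ^ (-(a - b + (0 : ℕ))) := by
      have e5 : (y / w) ^ b ≤ (1 + y / w) ^ b := by gcongr; linarith
      have e6 : (1 + y / w) ^ b = (1 + y / w) ^ a * (1 + y / w) ^ (-(a - b + (0 : ℕ))) := by
        rw [← rpow_natCast, ← rpow_add hs]; congr 1; push_cast; ring
      calc (y / w) ^ b * exp (-y / (2 * w))
          ≤ ((C * exp (1 / 2 * (y / w))) * (1 + y / w) ^ (-(a - b + (0 : ℕ)))) *
            exp (-y / (2 * w)) := by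
              rw [e6] at e5
              refine mul_le_mul_of_nonneg_right (e5.trans ?_) (exp_pos _).le
              gcongr
        _ = C * (1 + y / w) ^ (-(a - b + (0 : ℕ))) *
            (exp (1 / 2 * (y / w)) * exp (-y / (2 * w))) := by ring
        _ = C * (1 + y / w) ^ (-(a - b + (0 : ℕ))) := by
            rw [← exp_add]
            have : 1 / 2 * (y / w) + -y / (2 * w) = 0 := by field_simp; ring
            rw [this, exp_zero, mul_one]
    calc y ^ b * w ^ (-a) * exp (-y / (2 * w))
        = (w ^ b * w ^ (-a)) * ((y / w) ^ b * exp (-y / (2 * w))) := by rw [e2]; ring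
      _ ≤ w ^ (-(a - b + (0 : ℕ))) * (C * (1 + y / w) ^ (-(a - b + (0 : ℕ)))) := by
          rw [e3]; gcongr
      _ = _ := by ring
  | succ k ih =>
    intro a b
    obtain ⟨C₁, hC₁, h₁⟩ := ih (a + 1) b
    obtain ⟨C₂, hC₂, h₂⟩ := ih (a + 2) (b + 1)
    refine ⟨|a| * C₁ + 1 / 2 * C₂, by positivity, fun y w hy hw => ?_⟩
    have h3 := h₁ y w hy hw
    have h4 := h₂ y w hy hw
    have e1 : a + 1 - b + k = a - b + (k + 1 : ℕ) := by push_cast; ring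
    have e2 : a + 2 - (b + 1 : ℕ) + k = a - b + (k + 1 : ℕ) := by push_cast; ring
    rw [e1] at h3
    rw [e2] at h4
    simp only [heatDeriv]
    refine (abs_add_le _ _).trans ?_
    rw [abs_mul, abs_mul, abs_neg, abs_of_pos (by norm_num : (0 : ℝ) < 1 / 2), add_mul, mul_assoc,
      mul_assoc]
    gcongr

/-! ### Gaussian bumps around graphs and their `L²` norms -/

section GraphIncidences

/-- Points of `ℝⁿ × ℝᵐ`, with the sup norm. -/
abbrev SplitPt (n m : ℕ) := (Fin n → ℝ) × (Fin m → ℝ)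

/-- Parameters of graphs of affine maps `ℝⁿ → ℝᵐ`: each row is a slope vector and an intercept. -/
abbrev GraphPar (n m : ℕ) := Fin m → (Fin n → ℝ) × ℝ

variable {n m : ℕ}

/-- The vertical displacement of the point `z` from the graph with parameter `θ`. -/
def graphDisp (θ : GraphPar n m) (z : SplitPt n m) (i : Fin m) : ℝ :=
  z.2 i - ∑ j, (θ i).1 j * z.1 j - (θ i).2

/-- A Gaussian bump of variance `τ` around the graph with parameter `θ`. -/
noncomputable def graphBump (τ : ℝ) (θ : GraphPar n m) (z : SplitPt n m) : ℝ :=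
  ∏ i, gaussKer τ (graphDisp θ z i)

/-- A Gaussian weight in the slopes. -/
noncomputable def slopeWeight (θ : GraphPar n m) : ℝ := ∏ i, ∏ j, exp (-(θ i).1 j ^ 2 / 2)

lemma slopeWeight_pos (θ : GraphPar n m) : 0 < slopeWeight θ :=
  Finset.prod_pos fun _ _ => Finset.prod_pos fun _ _ => exp_pos _

lemma graphBump_nonneg (τ : ℝ) (θ : GraphPar n m) (z : SplitPt n m) : 0 ≤ graphBump τ θ z :=
  Finset.prod_nonneg fun _ _ => gaussKer_nonneg _ _

lemma integral_of_lintegral_ofReal {X : Type*} [MeasurableSpace X] {μ : Measure X} {f : X → ℝ}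
    (hf : AEStronglyMeasurable f μ) (h0 : ∀ x, 0 ≤ f x) {c : ℝ} (hc : 0 ≤ c)
    (h : ∫⁻ x, ENNReal.ofReal (f x) ∂μ = ENNReal.ofReal c) :
    Integrable f μ ∧ ∫ x, f x ∂μ = c := by
  constructor
  · refine ⟨hf, ?_⟩
    rw [hasFiniteIntegral_iff_ofReal (Filter.Eventually.of_forall h0), h]
    exact ENNReal.ofReal_lt_top
  · rw [integral_eq_lintegral_of_nonneg_ae (Filter.Eventually.of_forall h0) hf, h,
      ENNReal.toReal_ofReal hc]

lemma prod_gaussKer {w : ℝ} (hw : 0 < w) (y : Fin m → ℝ) :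
    ∏ i, gaussKer w (y i) = heatDeriv 0 (m / 2) 0 (∑ i, y i ^ 2) w := by
  simp only [gaussKer, heatDeriv]
  rw [Finset.prod_mul_distrib, ← exp_sum, Finset.prod_const, Finset.card_univ, Fintype.card_fin,
    pow_zero, one_mul]
  congr 1
  · rw [sqrt_eq_rpow, ← rpow_neg hw.le, ← rpow_natCast, ← rpow_mul hw.le]
    congr 1
    ring
  · rw [← Finset.sum_div, Finset.sum_neg_distrib]

/-- The rows of `θ` are independent, so the integral factors into one-row integrals. The variances
enter only through their sum with the squared horizontal distance, so differencing in `τ` acts on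
the time variable of a heat kernel. -/
lemma integral_graphBump_mul {τ τ' : ℝ} (hτ : 0 < τ) (hτ' : 0 < τ') (z z' : SplitPt n m) :
    Integrable (fun θ => graphBump τ θ z * graphBump τ' θ z' * slopeWeight θ) ∧
    ∫ θ, graphBump τ θ z * graphBump τ' θ z' * slopeWeight θ =
      √(2 * π) ^ ((n + 1) * m) * heatDeriv 0 (m / 2) 0 (∑ i, (z.2 i - z'.2 i) ^ 2)
        (τ + τ' + ∑ j, (z.1 j - z'.1 j) ^ 2) := by
  let f : Fin m → (Fin n → ℝ) × ℝ → ℝ := fun i q =>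
    gaussKer τ (z.2 i - ∑ j, q.1 j * z.1 j - q.2) *
      gaussKer τ' (z'.2 i - ∑ j, q.1 j * z'.1 j - q.2) * ∏ j, exp (-q.1 j ^ 2 / 2)
  have hf : ∀ i, Integrable (f i) ∧ ∫ q, f i q = √(2 * π) ^ (n + 1) *
        gaussKer (τ + τ' + ∑ j, (z.1 j - z'.1 j) ^ 2) (z.2 i - z'.2 i) := by
    intro i
    refine integral_of_lintegral_ofReal ?_ (fun q => ?_) ?_
      (lintegral_gaussKer_affine hτ hτ' z.1 z'.1 (z.2 i) (z'.2 i))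
    · exact Continuous.aestronglyMeasurable (by fun_prop)
    · exact mul_nonneg (mul_nonneg (gaussKer_nonneg _ _) (gaussKer_nonneg _ _))
        (Finset.prod_nonneg fun _ _ => (exp_pos _).le)
    · exact mul_nonneg (by positivity) (gaussKer_nonneg _ _)
  have hF : (fun θ : GraphPar n m => graphBump τ θ z * graphBump τ' θ z' * slopeWeight θ) =
      fun θ => ∏ i, f i (θ i) := by
    funext θ
    simp only [graphBump, slopeWeight, graphDisp, f, Finset.prod_mul_distrib]
  rw [hF]
  refine ⟨Integrable.fintype_prod_dep fun i => (hf i).1, ?_⟩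
  rw [integral_fintype_prod_volume_eq_prod, Finset.prod_congr rfl fun i _ => (hf i).2,
    Finset.prod_mul_distrib, Finset.prod_const, Finset.card_univ, Fintype.card_fin, ← pow_mul,
    ← prod_gaussKer (by positivity)]

/-- For `ρ ≤ s` each term of the difference is at most a constant times `s ^ (-m)`. For `ρ > s` the
`K`-th derivative is `O(ρ ^ (-(m + 2 * K)))`, because `w + y ≥ ρ ^ 2`, and differencing contributes
`s ^ (2 * K)`. The other variance `σ` is only carried along: cancellation in one of the two bumps
suffices. -/
lemma exists_abs_dilDiff_heat_le (m K : ℕ) : ∃ C : ℝ, 0 ≤ C ∧ ∀ s v y ρ : ℝ, 0 < s → 0 ≤ v →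
    0 ≤ y → 0 ≤ ρ → ρ ^ 2 ≤ v + y → ∀ σ : ℝ, 0 < σ →
    |dilDiff K (fun r => heatDeriv 0 (m / 2) 0 y (r + σ + v)) (s ^ 2)| ≤
      C * ((s ^ m)⁻¹ * ((1 + ρ / s) ^ (m + 2 * K))⁻¹) := by
  obtain ⟨c, hc⟩ := exists_dilDiff_eq_sum K
  obtain ⟨C₁, hC₁, h₁⟩ := exists_abs_dilDiff_le K
  obtain ⟨C₂, hC₂, h₂⟩ := exists_abs_heatDeriv_le K (m / 2) 0
  have hsum : 0 ≤ ∑ i ∈ Finset.range (K + 1), |c i| := Finset.sum_nonneg fun _ _ => abs_nonneg _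
  refine ⟨2 ^ (m + 2 * K) * (∑ i ∈ Finset.range (K + 1), |c i| + C₁ * C₂), by positivity,
    fun s v y ρ hs hv hy hρ hρ2 σ hσ => ?_⟩
  rcases le_or_gt ρ s with hle | hlt
  · have hA : |dilDiff K (fun r => heatDeriv 0 (m / 2) 0 y (r + σ + v)) (s ^ 2)| ≤
        (∑ i ∈ Finset.range (K + 1), |c i|) * (s ^ m)⁻¹ := by
      rw [hc, Finset.sum_mul]
      refine (Finset.abs_sum_le_sum_abs _ _).trans (Finset.sum_le_sum fun i _ => ?_)
      rw [abs_mul]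
      refine mul_le_mul_of_nonneg_left ?_ (abs_nonneg _)
      have h4 : (1 : ℝ) ≤ 4 ^ i := one_le_pow₀ (by norm_num)
      have hw : s ^ 2 ≤ 4 ^ i * s ^ 2 + σ + v := by nlinarith [sq_nonneg s]
      have hs2 : 0 < s ^ 2 := by positivity
      have hw0 : 0 < 4 ^ i * s ^ 2 + σ + v := lt_of_lt_of_le hs2 hw
      simp only [heatDeriv, pow_zero, one_mul]
      rw [abs_of_nonneg (by positivity)]
      calc _ ≤ (s ^ 2) ^ (-(m / 2 : ℝ)) * 1 := by
            refine mul_le_mul ?_ ?_ (exp_pos _).le (by positivity)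
            · exact rpow_le_rpow_of_nonpos hs2 hw (by simp; positivity)
            · rw [exp_le_one_iff]
              exact div_nonpos_of_nonpos_of_nonneg (by linarith) (by positivity)
        _ = (s ^ m)⁻¹ := by
            rw [mul_one, ← rpow_natCast s 2, ← rpow_mul hs.le, ← rpow_natCast s m,
              ← rpow_neg hs.le]
            congr 1
            push_cast
            ring
    have hB : 1 ≤ 2 ^ (m + 2 * K) * ((1 + ρ / s) ^ (m + 2 * K))⁻¹ := by
      rw [← inv_pow, ← mul_pow]
      refine one_le_pow₀ ?_
      rw [← div_eq_mul_inv, one_le_div (by positivity)]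
      have : ρ / s ≤ 1 := (div_le_one hs).2 hle
      linarith
    calc _ ≤ (∑ i ∈ Finset.range (K + 1), |c i|) * (s ^ m)⁻¹ := hA
      _ ≤ (∑ i ∈ Finset.range (K + 1), |c i| + C₁ * C₂) * (s ^ m)⁻¹ := by
          gcongr
          linarith [mul_nonneg hC₁ hC₂]
      _ ≤ (∑ i ∈ Finset.range (K + 1), |c i| + C₁ * C₂) * (s ^ m)⁻¹ *
          (2 ^ (m + 2 * K) * ((1 + ρ / s) ^ (m + 2 * K))⁻¹) :=
          le_mul_of_one_le_right (by positivity) hB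
      _ = _ := by ring
  · have hρ0 : 0 < ρ := hs.trans hlt
    have hvy : 0 < v + y := lt_of_lt_of_le (by positivity) hρ2
    have hA := h₁ (fun k r => heatDeriv k (m / 2) 0 y (r + σ + v)) (C₂ * (ρ ^ (m + 2 * K))⁻¹)
      (fun k r hr => by
        have h := hasDerivAt_heatDeriv k y (w := r + σ + v) (by positivity) (m / 2) 0
        have h3 : HasDerivAt (fun r : ℝ => r + σ + v) 1 r :=
          ((hasDerivAt_id r).add_const σ).add_const v
        have := h.comp r h3
        rwa [mul_one] at this)
      (fun r hr => by
        refine (h₂ y (r + σ + v) hy (by positivity)).trans ?_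
        gcongr
        calc (r + σ + v + y) ^ (-(m / 2 - (0 : ℕ) + K : ℝ))
            ≤ (ρ ^ 2) ^ (-(m / 2 - (0 : ℕ) + K : ℝ)) :=
              rpow_le_rpow_of_nonpos (by positivity) (by linarith)
                (by rw [neg_nonpos, Nat.cast_zero, sub_zero]; positivity)
          _ = (ρ ^ (m + 2 * K))⁻¹ := by
              rw [← rpow_natCast ρ 2, ← rpow_mul hρ, ← rpow_natCast ρ (m + 2 * K),
                ← rpow_neg hρ]
              congr 1
              push_cast
              ring)
      (s ^ 2) (by positivity)
    refine hA.trans ?_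
    have hB : (ρ ^ (m + 2 * K))⁻¹ * (s ^ 2) ^ K ≤
        2 ^ (m + 2 * K) * ((s ^ m)⁻¹ * ((1 + ρ / s) ^ (m + 2 * K))⁻¹) := by
      have e1 : (ρ ^ (m + 2 * K))⁻¹ * (s ^ 2) ^ K =
          (s ^ m)⁻¹ * ((ρ / s) ^ (m + 2 * K))⁻¹ := by
        rw [div_pow, pow_add s, pow_mul s]
        field_simp
      have e2 : ((ρ / s) ^ (m + 2 * K))⁻¹ ≤
          2 ^ (m + 2 * K) * ((1 + ρ / s) ^ (m + 2 * K))⁻¹ := by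
        rw [← inv_pow, ← inv_pow, ← mul_pow]
        gcongr
        have h1 : 1 ≤ ρ / s := (one_le_div hs).2 hlt.le
        rw [← div_eq_mul_inv, inv_le_iff_one_le_mul₀ (by positivity), div_mul_eq_mul_div,
          one_le_div (by positivity)]
        linarith
      rw [e1]
      calc _ ≤ (s ^ m)⁻¹ * (2 ^ (m + 2 * K) * ((1 + ρ / s) ^ (m + 2 * K))⁻¹) := by gcongr
        _ = _ := by ring
    calc C₁ * (C₂ * (ρ ^ (m + 2 * K))⁻¹) * (s ^ 2) ^ K
        = C₁ * C₂ * ((ρ ^ (m + 2 * K))⁻¹ * (s ^ 2) ^ K) := by ring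
      _ ≤ (∑ i ∈ Finset.range (K + 1), |c i| + C₁ * C₂) *
          (2 ^ (m + 2 * K) * ((s ^ m)⁻¹ * ((1 + ρ / s) ^ (m + 2 * K))⁻¹)) := by
          gcongr
          linarith
      _ = _ := by ring

lemma norm_sq_le_sum_sq (z : SplitPt n m) : ‖z‖ ^ 2 ≤ ∑ j, z.1 j ^ 2 + ∑ i, z.2 i ^ 2 := by
  have h0 : 0 ≤ ∑ j, z.1 j ^ 2 + ∑ i, z.2 i ^ 2 := by positivity
  suffices ‖z‖ ≤ √(∑ j, z.1 j ^ 2 + ∑ i, z.2 i ^ 2) by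
    calc ‖z‖ ^ 2 ≤ √(∑ j, z.1 j ^ 2 + ∑ i, z.2 i ^ 2) ^ 2 := by gcongr
      _ = _ := sq_sqrt h0
  rw [Prod.norm_def]
  refine max_le ((pi_norm_le_iff_of_nonneg (sqrt_nonneg _)).2 fun j => ?_)
    ((pi_norm_le_iff_of_nonneg (sqrt_nonneg _)).2 fun i => ?_)
  · refine abs_le_sqrt ?_
    have h1 := Finset.single_le_sum (f := fun j => z.1 j ^ 2) (fun _ _ => sq_nonneg _)
      (Finset.mem_univ j)
    have h2 : 0 ≤ ∑ i, z.2 i ^ 2 := by positivity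
    linarith
  · refine abs_le_sqrt ?_
    have h1 := Finset.single_le_sum (f := fun i => z.2 i ^ 2) (fun _ _ => sq_nonneg _)
      (Finset.mem_univ i)
    have h2 : 0 ≤ ∑ i, z.1 i ^ 2 := by positivity
    linarith

/-- The `L²` norm, over all graphs, of a scale-`s` difference of the masses of bumps is controlled
by a kernel concentrated at scale `s`. -/
lemma exists_integral_dilDiff_sq_le (n m K : ℕ) : ∃ C : ℝ, 0 ≤ C ∧ ∀ {α : Type} (P : Finset α)
    (z : α → SplitPt n m) (s : ℝ), 0 < s →
    Integrable (fun θ => dilDiff K (fun τ => ∑ p ∈ P, graphBump τ θ (z p)) (s ^ 2) ^ 2 *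
      slopeWeight θ) ∧
    ∫ θ, dilDiff K (fun τ => ∑ p ∈ P, graphBump τ θ (z p)) (s ^ 2) ^ 2 * slopeWeight θ ≤
      C * ∑ p ∈ P, ∑ q ∈ P, (s ^ m)⁻¹ * ((1 + ‖z p - z q‖ / s) ^ (m + 2 * K))⁻¹ := by
  obtain ⟨c, hc⟩ := exists_dilDiff_eq_sum K
  obtain ⟨C, hC, h⟩ := exists_abs_dilDiff_heat_le m K
  have hsum : 0 ≤ ∑ i ∈ Finset.range (K + 1), |c i| := Finset.sum_nonneg fun _ _ => abs_nonneg _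
  refine ⟨√(2 * π) ^ ((n + 1) * m) * (∑ i ∈ Finset.range (K + 1), |c i|) * C, by positivity,
    fun {α} P z s hs => ?_⟩
  have hexp : ∀ θ, dilDiff K (fun τ => ∑ p ∈ P, graphBump τ θ (z p)) (s ^ 2) ^ 2 *
      slopeWeight θ = ∑ p ∈ P, ∑ q ∈ P, ∑ l ∈ Finset.range (K + 1), ∑ k ∈ Finset.range (K + 1),
        c l * c k * (graphBump (4 ^ k * s ^ 2) θ (z p) * graphBump (4 ^ l * s ^ 2) θ (z q) *
          slopeWeight θ) := by
    intro θ
    have e : dilDiff K (fun τ => ∑ p ∈ P, graphBump τ θ (z p)) (s ^ 2) =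
        ∑ p ∈ P, ∑ k ∈ Finset.range (K + 1), c k * graphBump (4 ^ k * s ^ 2) θ (z p) := by
      rw [hc, Finset.sum_comm]
      simp_rw [Finset.mul_sum]
    rw [e, sq, Finset.sum_mul_sum, Finset.sum_mul]
    refine Finset.sum_congr rfl fun p _ => ?_
    rw [Finset.sum_mul]
    refine Finset.sum_congr rfl fun q _ => ?_
    rw [Finset.sum_mul_sum, Finset.sum_mul, Finset.sum_comm]
    simp_rw [Finset.sum_mul]
    refine Finset.sum_congr rfl fun l _ => Finset.sum_congr rfl fun k _ => ?_
    ring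
  have hI : ∀ k l p q, Integrable (fun θ => c l * c k * (graphBump (4 ^ k * s ^ 2) θ (z p) *
      graphBump (4 ^ l * s ^ 2) θ (z q) * slopeWeight θ)) := fun k l p q =>
    (integral_graphBump_mul (by positivity) (by positivity) _ _).1.const_mul _
  simp_rw [hexp]
  refine ⟨integrable_finsetSum _ fun p _ => integrable_finsetSum _ fun q _ =>
    integrable_finsetSum _ fun l _ => integrable_finsetSum _ fun k _ => hI k l p q, ?_⟩
  rw [integral_finsetSum _ fun p _ => integrable_finsetSum _ fun q _ =>
    integrable_finsetSum _ fun l _ => integrable_finsetSum _ fun k _ => hI k l p q,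
    Finset.mul_sum]
  refine Finset.sum_le_sum fun p _ => ?_
  rw [integral_finsetSum _ fun q _ =>
    integrable_finsetSum _ fun l _ => integrable_finsetSum _ fun k _ => hI k l p q,
    Finset.mul_sum]
  refine Finset.sum_le_sum fun q _ => ?_
  rw [integral_finsetSum _ fun l _ => integrable_finsetSum _ fun k _ => hI k l p q]
  -- The sum over `k` is reassembled into a difference in the variance of the bump at `z p`; the sum
  -- over `l` stays expanded, with `4 ^ l * s ^ 2` in the role of `σ`.
  have hl : ∀ l, ∫ θ, ∑ k ∈ Finset.range (K + 1), c l * c k *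
      (graphBump (4 ^ k * s ^ 2) θ (z p) * graphBump (4 ^ l * s ^ 2) θ (z q) * slopeWeight θ) =
      √(2 * π) ^ ((n + 1) * m) * (c l * dilDiff K (fun r => heatDeriv 0 (m / 2) 0
        (∑ i, ((z p).2 i - (z q).2 i) ^ 2)
        (r + 4 ^ l * s ^ 2 + ∑ j, ((z p).1 j - (z q).1 j) ^ 2)) (s ^ 2)) := by
    intro l
    rw [integral_finsetSum _ fun k _ => hI k l p q, hc, Finset.mul_sum, Finset.mul_sum]
    refine Finset.sum_congr rfl fun k _ => ?_
    rw [integral_const_mul, (integral_graphBump_mul (by positivity) (by positivity) _ _).2]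
    ring
  simp_rw [hl]
  rw [← Finset.mul_sum, mul_assoc, mul_assoc]
  refine mul_le_mul_of_nonneg_left ?_ (by positivity)
  rw [Finset.sum_mul]
  refine Finset.sum_le_sum fun l _ => (le_abs_self _).trans ?_
  rw [abs_mul]
  refine mul_le_mul_of_nonneg_left (h s _ _ _ hs (by positivity) (by positivity) (norm_nonneg _)
    ?_ _ (by positivity)) (abs_nonneg _)
  exact norm_sq_le_sum_sq (z p - z q)

/-! ### Point sets with few points in balls -/

instance : (volume : Measure (SplitPt n m)).IsAddHaarMeasure :=
  Measure.prod.instIsAddHaarMeasure (volume : Measure (Fin n → ℝ)) (volume : Measure (Fin m → ℝ))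

lemma volume_real_closedBall_splitPt (x : SplitPt n m) {s : ℝ} (hs : 0 ≤ s) :
    volume.real (Metric.closedBall x s) = (2 * s) ^ (n + m) := by
  rw [← Prod.mk.eta (p := x), ← closedBall_prod_same, Measure.volume_eq_prod,
    measureReal_def, Measure.prod_prod, Real.volume_pi_closedBall _ hs,
    Real.volume_pi_closedBall _ hs, ← ENNReal.ofReal_mul (by positivity),
    ENNReal.toReal_ofReal (by positivity), Fintype.card_fin, Fintype.card_fin, pow_add]

/-- A finite point set with at most `F * s ^ t` points in every `s`-ball is dominated, at scale `s`,
by a multiple of Lebesgue measure. -/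
lemma sum_le_integral_of_card_ball_le {α : Type} (P : Finset α) (z : α → SplitPt n m)
    {s A : ℝ} (hs : 0 < s)
    (hF : ∀ c, ((P.filter fun p => dist (z p) c ≤ s).card : ℝ) ≤ A)
    {h : α → ℝ} {H : SplitPt n m → ℝ} (hH : Integrable H) (hH0 : ∀ x, 0 ≤ H x)
    (hle : ∀ p ∈ P, ∀ x, dist x (z p) ≤ s → h p ≤ H x) :
    ∑ p ∈ P, h p ≤ A * ((2 * s) ^ (n + m))⁻¹ * ∫ x, H x := by
  have hv : (0 : ℝ) < (2 * s) ^ (n + m) := by positivity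
  have hi : ∀ p, Integrable ((Metric.closedBall (z p) s).indicator H) := fun p =>
    hH.indicator Metric.isClosed_closedBall.measurableSet
  have h1 : ∀ p ∈ P, (2 * s) ^ (n + m) * h p ≤ ∫ x, (Metric.closedBall (z p) s).indicator H x := by
    intro p hp
    rw [integral_indicator Metric.isClosed_closedBall.measurableSet]
    have hfin : volume (Metric.closedBall (z p) s) ≠ ∞ := measure_closedBall_lt_top.ne
    calc (2 * s) ^ (n + m) * h p = ∫ x in Metric.closedBall (z p) s, h p := by
          rw [setIntegral_const, volume_real_closedBall_splitPt _ hs.le, smul_eq_mul]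
      _ ≤ _ := setIntegral_mono_on (integrableOn_const hfin) hH.integrableOn
          Metric.isClosed_closedBall.measurableSet fun x hx => hle p hp x hx
  have h2 : (2 * s) ^ (n + m) * ∑ p ∈ P, h p ≤ A * ∫ x, H x := by
    calc (2 * s) ^ (n + m) * ∑ p ∈ P, h p
        ≤ ∑ p ∈ P, ∫ x, (Metric.closedBall (z p) s).indicator H x := by
          rw [Finset.mul_sum]; exact Finset.sum_le_sum h1
      _ = ∫ x, ∑ p ∈ P, (Metric.closedBall (z p) s).indicator H x :=
          (integral_finsetSum _ fun p _ => hi p).symm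
      _ ≤ ∫ x, A * H x := by
          refine integral_mono (integrable_finsetSum _ fun p _ => hi p) (hH.const_mul A) fun x => ?_
          have : ∑ p ∈ P, (Metric.closedBall (z p) s).indicator H x =
              ((P.filter fun p => dist (z p) x ≤ s).card : ℝ) * H x := by
            rw [← nsmul_eq_mul, ← Finset.sum_const, Finset.sum_filter]
            refine Finset.sum_congr rfl fun p _ => ?_
            simp only [Set.indicator, Metric.mem_closedBall, dist_comm x]
          simp only [this]
          exact mul_le_mul_of_nonneg_right (hF x) (hH0 x)
      _ = A * ∫ x, H x := integral_const_mul _ _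
  rw [mul_right_comm, ← div_eq_mul_inv, le_div_iff₀ hv, mul_comm]
  exact h2

lemma integrable_inv_one_add_norm_pow {M : ℕ} (hM : n + m < M) :
    Integrable fun x : SplitPt n m => ((1 + ‖x‖) ^ M)⁻¹ := by
  have h := integrable_one_add_norm (E := SplitPt n m) (μ := volume) (r := M)
    (by simp only [Module.finrank_prod, Module.finrank_fintype_fun_eq_card, Fintype.card_fin]
        exact_mod_cast hM)
  refine h.congr (Filter.Eventually.of_forall fun x => ?_)
  simp only
  rw [rpow_neg (by positivity), rpow_natCast]

/-- The sum is compared with an integral that converges because `M` exceeds the dimension. Moving a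
point by at most `s` changes `1 + ‖c - z q‖ / s` by a factor at most `2`, which costs `2 ^ M`. -/
lemma exists_sum_inv_one_add_pow_le (n m : ℕ) {M : ℕ} (hM : n + m < M) :
    ∃ C : ℝ, 0 ≤ C ∧ ∀ {α : Type} (P : Finset α) (z : α → SplitPt n m) (s A : ℝ), 0 < s →
      (∀ c, ((P.filter fun p => dist (z p) c ≤ s).card : ℝ) ≤ A) → ∀ c,
      ∑ q ∈ P, ((1 + ‖c - z q‖ / s) ^ M)⁻¹ ≤ C * A := by
  refine ⟨∫ x : SplitPt n m, 2 ^ M * ((1 + ‖x‖) ^ M)⁻¹,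
    integral_nonneg fun x => by positivity, fun P z s A hs hA c => ?_⟩
  have hA0 : 0 ≤ A := (Nat.cast_nonneg _).trans (hA 0)
  have hI : Integrable fun x : SplitPt n m => 2 ^ M * ((1 + ‖x‖) ^ M)⁻¹ :=
    (integrable_inv_one_add_norm_pow hM).const_mul _
  have hI2 : Integrable fun x : SplitPt n m => 2 ^ M * ((1 + ‖s⁻¹ • (x - c)‖) ^ M)⁻¹ :=
    (hI.comp_smul (inv_ne_zero hs.ne')).comp_sub_right c
  have key := sum_le_integral_of_card_ball_le P z hs hA
    (h := fun q => ((1 + ‖c - z q‖ / s) ^ M)⁻¹) hI2 (fun x => by positivity)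
    (fun p _ x hx => by
      have e : ‖s⁻¹ • (x - c)‖ = ‖x - c‖ / s := by
        rw [norm_smul, norm_inv, Real.norm_eq_abs, abs_of_pos hs]; ring
      rw [e, ← inv_pow, ← inv_pow, ← mul_pow]
      gcongr
      have h1 : ‖x - c‖ ≤ s + ‖c - z p‖ := by
        have := dist_triangle x (z p) c
        rw [dist_eq_norm x c, dist_comm (z p), dist_eq_norm c] at this
        linarith
      have h2 : ‖x - c‖ / s ≤ 1 + ‖c - z p‖ / s := by
        rw [div_le_iff₀ hs, add_mul, div_mul_cancel₀ _ hs.ne']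
        linarith
      have h3 : 0 ≤ ‖c - z p‖ / s := by positivity
      rw [← div_eq_mul_inv, inv_le_iff_one_le_mul₀ (by positivity), div_mul_eq_mul_div,
        one_le_div (by positivity)]
      linarith)
  refine key.trans ?_
  rw [integral_sub_right_eq_self (fun x : SplitPt n m => 2 ^ M * ((1 + ‖s⁻¹ • x‖) ^ M)⁻¹) c,
    Measure.integral_comp_smul volume (fun x : SplitPt n m => 2 ^ M * ((1 + ‖x‖) ^ M)⁻¹)]
  simp only [Module.finrank_prod, Module.finrank_fintype_fun_eq_card, Fintype.card_fin]
  have hI0 : 0 ≤ ∫ x : SplitPt n m, 2 ^ M * ((1 + ‖x‖) ^ M)⁻¹ :=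
    integral_nonneg fun x => by positivity
  rw [abs_of_pos (by positivity), smul_eq_mul, mul_comm _ A, mul_assoc]
  refine mul_le_mul_of_nonneg_left ?_ hA0
  rw [← mul_assoc]
  refine mul_le_of_le_one_left hI0 ?_
  rw [inv_pow, inv_inv, mul_pow, mul_inv, mul_assoc, inv_mul_cancel₀ (by positivity), mul_one]
  exact inv_le_one_of_one_le₀ (one_le_pow₀ (by norm_num))

/-- `L²` bound for scale-`s` differences, for point sets with few points in `s`-balls. -/
lemma exists_integral_dilDiff_sq_le_of_card_ball_le (n m : ℕ) {K : ℕ} (hK : n < 2 * K) :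
    ∃ C : ℝ, 0 ≤ C ∧ ∀ {α : Type} (P : Finset α) (z : α → SplitPt n m) (s A : ℝ), 0 < s →
      (∀ c, ((P.filter fun p => dist (z p) c ≤ s).card : ℝ) ≤ A) →
      ∫ θ, dilDiff K (fun τ => ∑ p ∈ P, graphBump τ θ (z p)) (s ^ 2) ^ 2 * slopeWeight θ ≤
        C * (P.card * A * (s ^ m)⁻¹) := by
  obtain ⟨C₁, hC₁, h₁⟩ := exists_integral_dilDiff_sq_le n m K
  obtain ⟨C₂, hC₂, h₂⟩ := exists_sum_inv_one_add_pow_le n m (M := m + 2 * K) (by omega)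
  refine ⟨C₁ * C₂, by positivity, fun P z s A hs hA => ((h₁ P z s hs).2).trans ?_⟩
  rw [mul_assoc C₁]
  refine mul_le_mul_of_nonneg_left ?_ hC₁
  calc ∑ p ∈ P, ∑ q ∈ P, (s ^ m)⁻¹ * ((1 + ‖z p - z q‖ / s) ^ (m + 2 * K))⁻¹
      ≤ ∑ p ∈ P, (s ^ m)⁻¹ * (C₂ * A) := by
        refine Finset.sum_le_sum fun p _ => ?_
        rw [← Finset.mul_sum]
        exact mul_le_mul_of_nonneg_left (h₂ P z s A hs hA (z p)) (by positivity)
    _ = _ := by rw [Finset.sum_const, nsmul_eq_mul]; ring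

/-- Since `r₀ ^ 2 ≤ 2 * r ^ 2 + 2 * (L * s) ^ 2`, a shift of the argument by a multiple of the
standard deviation is paid for by doubling the variance. -/
lemma gaussKer_le_gaussKer_two_mul {s : ℝ} (hs : 0 < s) {r r₀ L : ℝ} (h : |r - r₀| ≤ L * s) :
    gaussKer (s ^ 2) r ≤ √2 * exp (L ^ 2 / 2) * gaussKer (2 * s ^ 2) r₀ := by
  unfold gaussKer
  rw [sqrt_mul (by norm_num), sqrt_sq hs.le]
  have h2 : (r - r₀) ^ 2 ≤ (L * s) ^ 2 := sq_le_sq' (by linarith [abs_le.1 h]) (abs_le.1 h).2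
  have h3 : r₀ ^ 2 ≤ 2 * r ^ 2 + 2 * (L * s) ^ 2 := by nlinarith [sq_nonneg (r + (r - r₀))]
  have e : √2 * exp (L ^ 2 / 2) * ((√2 * s)⁻¹ * exp (-r₀ ^ 2 / (2 * (2 * s ^ 2)))) =
      s⁻¹ * exp (L ^ 2 / 2 + -r₀ ^ 2 / (2 * (2 * s ^ 2))) := by
    rw [exp_add]
    field_simp
  rw [e]
  gcongr
  have : L ^ 2 / 2 + -r₀ ^ 2 / (2 * (2 * s ^ 2)) - -r ^ 2 / (2 * s ^ 2) =
      (2 * r ^ 2 + 2 * (L * s) ^ 2 - r₀ ^ 2) / (4 * s ^ 2) := by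
    field_simp
    ring
  have h4 : 0 ≤ (2 * r ^ 2 + 2 * (L * s) ^ 2 - r₀ ^ 2) / (4 * s ^ 2) :=
    div_nonneg (by linarith) (by positivity)
  linarith

lemma lintegral_prod_gaussKer {τ : ℝ} (hτ : 0 < τ) (c : Fin m → ℝ) :
    ∫⁻ y : Fin m → ℝ, ENNReal.ofReal (∏ i, gaussKer τ (y i - c i)) =
      ENNReal.ofReal (√(2 * π) ^ m) := by
  have h1 : ∀ i, Integrable (fun r => gaussKer τ (r - c i)) ∧
      ∫ r, gaussKer τ (r - c i) = √(2 * π) := by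
    intro i
    refine integral_of_lintegral_ofReal (Continuous.aestronglyMeasurable (by fun_prop))
      (fun r => gaussKer_nonneg _ _) (by positivity) ?_
    have e : ∀ r : ℝ, ENNReal.ofReal (gaussKer τ (r - c i)) = ENNReal.ofReal (√τ)⁻¹ *
        ENNReal.ofReal (exp (-(1 / (2 * τ)) * (r - c i) ^ 2)) := by
      intro r
      rw [← ENNReal.ofReal_mul (by positivity), gaussKer]
      congr 3
      ring
    simp_rw [e]
    rw [lintegral_const_mul _ (by fun_prop), lintegral_exp_neg_mul_sub_sq (by positivity),
      ← ENNReal.ofReal_mul (by positivity)]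
    congr 1
    rw [show π / (1 / (2 * τ)) = 2 * π * τ by field_simp, sqrt_mul (by positivity)]
    have := (sqrt_pos.2 hτ).ne'
    field_simp
  have h2 : Integrable fun y : Fin m → ℝ => ∏ i, gaussKer τ (y i - c i) :=
    Integrable.fintype_prod_dep fun i => (h1 i).1
  have h3 := integral_fintype_prod_volume_eq_prod (𝕜 := ℝ) fun i r => gaussKer τ (r - c i)
  rw [← ofReal_integral_eq_lintegral_ofReal h2
    (Filter.Eventually.of_forall fun y => Finset.prod_nonneg fun _ _ => gaussKer_nonneg _ _)]
  congr 1
  refine h3.trans ?_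
  rw [Finset.prod_congr rfl fun i _ => (h1 i).2]
  simp

/-- On each vertical fibre the bump has the same total mass, whatever the graph, so only the volume
of the base cube appears. -/
lemma integral_indicator_mul_graphBump {τ R : ℝ} (hτ : 0 < τ) (hR : 0 ≤ R) (θ : GraphPar n m) :
    Integrable (fun x : SplitPt n m =>
      (Metric.closedBall (0 : Fin n → ℝ) R).indicator 1 x.1 * graphBump τ θ x) ∧
    ∫ x : SplitPt n m, (Metric.closedBall (0 : Fin n → ℝ) R).indicator 1 x.1 * graphBump τ θ x =
      (2 * R) ^ n * √(2 * π) ^ m := by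
  have hmeas : Measurable fun x : SplitPt n m =>
      (Metric.closedBall (0 : Fin n → ℝ) R).indicator (1 : (Fin n → ℝ) → ℝ) x.1 *
        graphBump τ θ x := by
    refine Measurable.mul ?_ ?_
    · exact (measurable_one.indicator Metric.isClosed_closedBall.measurableSet).comp measurable_fst
    · unfold graphBump graphDisp
      exact Continuous.measurable (by fun_prop)
  have h01 : ∀ x : Fin n → ℝ, 0 ≤ (Metric.closedBall (0 : Fin n → ℝ) R).indicator
      (1 : (Fin n → ℝ) → ℝ) x := fun x => Set.indicator_nonneg (fun _ _ => zero_le_one) x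
  refine integral_of_lintegral_ofReal hmeas.aestronglyMeasurable
    (fun x => mul_nonneg (h01 _) (graphBump_nonneg _ _ _)) (by positivity) ?_
  rw [Measure.volume_eq_prod, lintegral_prod _ hmeas.ennreal_ofReal.aemeasurable]
  have key : ∀ x : Fin n → ℝ, ∫⁻ y : Fin m → ℝ, ENNReal.ofReal
      ((Metric.closedBall (0 : Fin n → ℝ) R).indicator 1 x * graphBump τ θ (x, y)) =
      (Metric.closedBall (0 : Fin n → ℝ) R).indicator
        (fun _ => ENNReal.ofReal (√(2 * π) ^ m)) x := by
    intro x
    by_cases hx : x ∈ Metric.closedBall (0 : Fin n → ℝ) R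
    · simp only [Set.indicator_of_mem hx, Pi.one_apply, one_mul]
      rw [← lintegral_prod_gaussKer hτ fun i => ∑ j, (θ i).1 j * x j + (θ i).2]
      refine lintegral_congr fun y => ?_
      simp only [graphBump, graphDisp, sub_sub]
    · simp [Set.indicator_of_notMem hx]
  simp_rw [key]
  rw [lintegral_indicator Metric.isClosed_closedBall.measurableSet, setLIntegral_const,
    Real.volume_pi_closedBall _ hR, ← ENNReal.ofReal_mul (by positivity), Fintype.card_fin,
    mul_comm]

/-- Pointwise bound for the mass near a single graph. -/
lemma exists_sum_graphBump_le (n m : ℕ) {S : ℝ} (hS : 0 ≤ S) :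
    ∃ C : ℝ, 0 ≤ C ∧ ∀ {α : Type} (P : Finset α) (z : α → SplitPt n m) (s A : ℝ), 0 < s → s ≤ S →
      (∀ c, ((P.filter fun p => dist (z p) c ≤ s).card : ℝ) ≤ A) →
      (∀ p ∈ P, ‖(z p).1‖ ≤ 1) → ∀ θ : GraphPar n m, (∀ i j, |(θ i).1 j| ≤ 2) →
      ∑ p ∈ P, graphBump (s ^ 2) θ (z p) ≤ C * (A * (s ^ (n + m))⁻¹) := by
  -- Moving a point by `s` in the sup norm changes the displacement by at most `s` vertically and `2
  -- * n * s` through the slopes, which are at most `2`; hence `1 + 2 * n`. The cutoff radius `1 +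
  -- S` contains the `s`-neighbourhood of the unit ball of the base.
  set E : ℝ := (√2 * exp ((1 + 2 * n : ℝ) ^ 2 / 2)) ^ m with hE
  refine ⟨E * ((2 * (1 + S)) ^ n * √(2 * π) ^ m), by positivity,
    fun P z s A hs hsS hA hz θ hθ => ?_⟩
  have hA0 : 0 ≤ A := (Nat.cast_nonneg _).trans (hA 0)
  obtain ⟨hI, hval⟩ := integral_indicator_mul_graphBump (τ := 2 * s ^ 2) (R := 1 + S)
    (by positivity) (by positivity) θ
  have h01 : ∀ x : Fin n → ℝ, 0 ≤ (Metric.closedBall (0 : Fin n → ℝ) (1 + S)).indicator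
      (1 : (Fin n → ℝ) → ℝ) x := fun x => Set.indicator_nonneg (fun _ _ => zero_le_one) x
  have key := sum_le_integral_of_card_ball_le P z hs hA
    (h := fun p => graphBump (s ^ 2) θ (z p)) (hI.const_mul E)
    (fun x => mul_nonneg (by positivity) (mul_nonneg (h01 _) (graphBump_nonneg _ _ _)))
    (fun p hp x hx => by
      rw [dist_eq_norm] at hx
      have hx1 : ‖x.1 - (z p).1‖ ≤ s := (norm_fst_le (x - z p)).trans hx
      have hx2 : ‖x.2 - (z p).2‖ ≤ s := (norm_snd_le (x - z p)).trans hx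
      have hmem : x.1 ∈ Metric.closedBall (0 : Fin n → ℝ) (1 + S) := by
        rw [mem_closedBall_zero_iff]
        have := norm_add_le (x.1 - (z p).1) (z p).1
        rw [sub_add_cancel] at this
        linarith [hz p hp]
      rw [Set.indicator_of_mem hmem, Pi.one_apply, one_mul, hE]
      unfold graphBump
      calc ∏ i, gaussKer (s ^ 2) (graphDisp θ (z p) i)
          ≤ ∏ i, (√2 * exp ((1 + 2 * n : ℝ) ^ 2 / 2) *
              gaussKer (2 * s ^ 2) (graphDisp θ x i)) := by
            refine Finset.prod_le_prod (fun _ _ => gaussKer_nonneg _ _) fun i _ =>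
              gaussKer_le_gaussKer_two_mul hs ?_
            have e : graphDisp θ (z p) i - graphDisp θ x i =
                -((x.2 - (z p).2) i) + ∑ j, (θ i).1 j * ((x.1 - (z p).1) j) := by
              simp only [graphDisp, Pi.sub_apply, mul_sub, Finset.sum_sub_distrib]
              ring
            rw [e]
            have e1 : |∑ j, (θ i).1 j * ((x.1 - (z p).1) j)| ≤ 2 * n * s := by
              refine (Finset.abs_sum_le_sum_abs _ _).trans ?_
              calc ∑ j, |(θ i).1 j * ((x.1 - (z p).1) j)| ≤ ∑ _j : Fin n, 2 * s := by
                    refine Finset.sum_le_sum fun j _ => ?_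
                    rw [abs_mul]
                    exact mul_le_mul (hθ i j) ((norm_le_pi_norm (x.1 - (z p).1) j).trans hx1)
                      (abs_nonneg _) (by norm_num)
                _ = 2 * n * s := by simp; ring
            have e2 : |(x.2 - (z p).2) i| ≤ s := (norm_le_pi_norm (x.2 - (z p).2) i).trans hx2
            refine (abs_add_le _ _).trans ?_
            rw [abs_neg]
            linarith
        _ = _ := by rw [Finset.prod_mul_distrib, Finset.prod_const]; simp)
  refine key.trans ?_
  rw [integral_const_mul, hval, mul_pow 2 s, mul_inv]
  have h2 : ((2 : ℝ) ^ (n + m))⁻¹ ≤ 1 := inv_le_one_of_one_le₀ (one_le_pow₀ (by norm_num))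
  calc A * (((2 : ℝ) ^ (n + m))⁻¹ * (s ^ (n + m))⁻¹) * (E * ((2 * (1 + S)) ^ n * √(2 * π) ^ m))
      ≤ A * (1 * (s ^ (n + m))⁻¹) * (E * ((2 * (1 + S)) ^ n * √(2 * π) ^ m)) := by gcongr
    _ = _ := by ring

/-! ### Volumes in parameter space, and recovery of a function from its differences -/

instance : (volume : Measure ((Fin n → ℝ) × ℝ)).IsAddHaarMeasure :=
  Measure.prod.instIsAddHaarMeasure (volume : Measure (Fin n → ℝ)) (volume : Measure ℝ)

instance : (volume : Measure (GraphPar n m)).IsAddHaarMeasure :=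
  Measure.pi.isAddHaarMeasure _

lemma volume_real_ball_graphPar (θ : GraphPar n m) {r : ℝ} (hr : 0 < r) :
    volume.real (Metric.ball θ r) =
      r ^ ((n + 1) * m) * volume.real (Metric.ball (0 : GraphPar n m) 1) := by
  rw [measureReal_def, Measure.addHaar_ball_of_pos volume θ hr, ENNReal.toReal_mul,
    ENNReal.toReal_ofReal (by positivity), measureReal_def]
  congr 2
  simp [Module.finrank_pi_fintype, mul_comm]

/-- Every factor `1 - 4^{-a} S` at most doubles the supremum and looks one scale further, hence the
range up to `N + a`. -/
lemma abs_dilDiff_le_two_pow_mul {f : ℝ → ℝ} {τ T : ℝ} {L : ℕ} (a : ℕ) : ∀ {N : ℕ},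
    (∀ j, L ≤ j → j ≤ N + a → |f (4 ^ j * τ)| ≤ T) →
    ∀ j, L ≤ j → j ≤ N → |dilDiff a f (4 ^ j * τ)| ≤ 2 ^ a * T := by
  induction a with
  | zero => intro N h j h1 h2; simpa [dilDiff] using h j h1 h2
  | succ a ih =>
    intro N h j h1 h2
    have h3 := ih (N := N + 1) (fun j hj hj' => h j hj (by omega)) j h1 (by omega)
    have h4 := ih (N := N + 1) (fun j hj hj' => h j hj (by omega)) (j + 1) (by omega) (by omega)
    rw [dilDiff_succ, ← mul_assoc, ← pow_succ']
    refine (abs_sub _ _).trans ?_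
    rw [abs_mul, abs_of_pos (by positivity : (0 : ℝ) < (4 ^ a)⁻¹)]
    have h5 : ((4 : ℝ) ^ a)⁻¹ ≤ 1 := inv_le_one_of_one_le₀ (one_le_pow₀ (by norm_num))
    have h6 : ((4 : ℝ) ^ a)⁻¹ * |dilDiff a f (4 ^ (j + 1) * τ)| ≤
        |dilDiff a f (4 ^ (j + 1) * τ)| := mul_le_of_le_one_left (abs_nonneg _) h5
    rw [pow_succ (2 : ℝ)]
    linarith

/-- Recovering a function from its dilation differences at `L` scales and its values at the
coarsest scales. -/
lemma abs_le_of_dilDiff_le {f : ℝ → ℝ} {τ T W : ℝ} {L K : ℕ} (hW0 : 0 ≤ W)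
    (hW : ∀ i < L, |dilDiff K f (4 ^ i * τ)| ≤ W)
    (hT : ∀ j, L ≤ j → j ≤ L + K → |f (4 ^ j * τ)| ≤ T) :
    |f τ| ≤ (L + 1) ^ K * (W + 2 ^ K * T) := by
  have hT0 : 0 ≤ T := (abs_nonneg _).trans (hT L le_rfl (by omega))
  set Q := W + 2 ^ K * T with hQ
  have hQ0 : 0 ≤ Q := by positivity
  have hTL : ∀ a ≤ K, |dilDiff a f (4 ^ L * τ)| ≤ Q := by
    intro a ha
    have h1 := abs_dilDiff_le_two_pow_mul a (N := L) (fun j hj hj' => hT j hj (by omega)) L le_rfl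
      le_rfl
    have h2 : (2 : ℝ) ^ a * T ≤ 2 ^ K * T := by
      gcongr
      norm_num
    linarith
  -- The factors of the operator are removed one by one, each removal costing a factor `L + 1`.
  have key : ∀ b ≤ K, ∀ j ≤ L, |dilDiff (K - b) f (4 ^ j * τ)| ≤ (L + 1) ^ b * Q := by
    intro b
    induction b with
    | zero =>
      intro _ j hj
      rw [pow_zero, one_mul, Nat.sub_zero]
      rcases hj.lt_or_eq with h | rfl
      · have h2 : 0 ≤ 2 ^ K * T := by positivity
        linarith [hW j h]
      · exact hTL K le_rfl
    | succ b ih =>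
      intro hb
      have hab : K - b = (K - (b + 1)) + 1 := by omega
      set a := K - (b + 1) with ha
      -- Telescoping down from scale `L`: the lower difference at one scale is the higher one there
      -- plus `4^{-a}` times the lower one at the next coarser scale, and `4^{-a} ≤ 1`.
      have hstep : ∀ i ≤ L, |dilDiff a f (4 ^ (L - i) * τ)| ≤ i * ((L + 1) ^ b * Q) + Q := by
        intro i
        induction i with
        | zero => intro _; simpa using hTL a (by omega)
        | succ i ihi =>
          intro hi
          have h1 := ihi (by omega)
          have h2 := ih (by omega) (L - (i + 1)) (by omega)
          rw [hab, dilDiff_succ, ← mul_assoc, ← pow_succ',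
            show L - (i + 1) + 1 = L - i by omega] at h2
          have h5 : ((4 : ℝ) ^ a)⁻¹ ≤ 1 := inv_le_one_of_one_le₀ (one_le_pow₀ (by norm_num))
          have h6 : |((4 : ℝ) ^ a)⁻¹ * dilDiff a f (4 ^ (L - i) * τ)| ≤
              |dilDiff a f (4 ^ (L - i) * τ)| := by
            rw [abs_mul, abs_of_pos (by positivity)]
            exact mul_le_of_le_one_left (abs_nonneg _) h5
          have h7 := abs_sub_abs_le_abs_sub (dilDiff a f (4 ^ (L - (i + 1)) * τ))
            (((4 : ℝ) ^ a)⁻¹ * dilDiff a f (4 ^ (L - i) * τ))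
          push_cast
          linarith
      intro j hj
      have h1 := hstep (L - j) (by omega)
      rw [show L - (L - j) = j by omega] at h1
      refine h1.trans ?_
      have h2 : ((L - j : ℕ) : ℝ) ≤ L := by exact_mod_cast Nat.sub_le _ _
      have h3 : (1 : ℝ) ≤ (L + 1 : ℝ) ^ b := 
        one_le_pow₀ (by linarith [(Nat.cast_nonneg L : (0 : ℝ) ≤ L)])
      calc ((L - j : ℕ) : ℝ) * ((L + 1) ^ b * Q) + Q
          ≤ L * ((L + 1) ^ b * Q) + (L + 1) ^ b * Q := by
            gcongr
            exact le_mul_of_one_le_left hQ0 h3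
        _ = (L + 1) ^ (b + 1) * Q := by ring
  simpa [dilDiff] using key K le_rfl 0 (Nat.zero_le _)

lemma abs_slope_sub_le (θ θ' : GraphPar n m) (i : Fin m) (j : Fin n) :
    |(θ i).1 j - (θ' i).1 j| ≤ dist θ θ' := by
  calc |(θ i).1 j - (θ' i).1 j| = dist ((θ i).1 j) ((θ' i).1 j) := rfl
    _ ≤ dist (θ i).1 (θ' i).1 := dist_le_pi_dist _ _ _
    _ ≤ dist (θ i) (θ' i) := le_max_left _ _
    _ ≤ dist θ θ' := dist_le_pi_dist _ _ _

lemma abs_intercept_sub_le (θ θ' : GraphPar n m) (i : Fin m) :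
    |(θ i).2 - (θ' i).2| ≤ dist θ θ' := by
  calc |(θ i).2 - (θ' i).2| = dist (θ i).2 (θ' i).2 := rfl
    _ ≤ dist (θ i) (θ' i) := le_max_right _ _
    _ ≤ dist θ θ' := dist_le_pi_dist _ _ _

lemma abs_graphDisp_sub_le (θ θ' : GraphPar n m) {z : SplitPt n m} (hz : ‖z.1‖ ≤ 1) (i : Fin m) :
    |graphDisp θ' z i - graphDisp θ z i| ≤ (n + 1) * dist θ θ' := by
  have e : graphDisp θ' z i - graphDisp θ z i =
      ∑ j, ((θ i).1 j - (θ' i).1 j) * z.1 j + ((θ i).2 - (θ' i).2) := by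
    simp only [graphDisp, sub_mul, Finset.sum_sub_distrib]
    ring
  rw [e, add_mul, one_mul]
  refine (abs_add_le _ _).trans (add_le_add ?_ (abs_intercept_sub_le θ θ' i))
  refine (Finset.abs_sum_le_sum_abs _ _).trans ?_
  calc ∑ j, |((θ i).1 j - (θ' i).1 j) * z.1 j| ≤ ∑ _j : Fin n, dist θ θ' := by
        refine Finset.sum_le_sum fun j _ => ?_
        rw [abs_mul]
        exact (mul_le_of_le_one_right (abs_nonneg _) ((norm_le_pi_norm z.1 j).trans hz)).trans
          (abs_slope_sub_le θ θ' i j)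
    _ = n * dist θ θ' := by simp

lemma le_graphBump {δ M : ℝ} (hδ : 0 < δ) {θ : GraphPar n m} {z : SplitPt n m}
    (h : ∀ i, |graphDisp θ z i| ≤ M * δ) :
    exp (-M ^ 2 / 2) ^ m * (δ ^ m)⁻¹ ≤ graphBump (δ ^ 2) θ z := by
  have e : exp (-M ^ 2 / 2) ^ m * (δ ^ m)⁻¹ = ∏ _i : Fin m, exp (-M ^ 2 / 2) * δ⁻¹ := by
    simp [mul_pow]
  rw [e]
  refine Finset.prod_le_prod (fun _ _ => by positivity) fun i _ => ?_
  unfold gaussKer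
  rw [sqrt_sq hδ.le, mul_comm]
  refine mul_le_mul_of_nonneg_left (exp_le_exp.2 ?_) (by positivity)
  have h2 : graphDisp θ z i ^ 2 ≤ (M * δ) ^ 2 :=
    sq_le_sq' (by linarith [abs_le.1 (h i)]) (abs_le.1 (h i)).2
  rw [div_le_div_iff₀ (by norm_num) (by positivity)]
  nlinarith

lemma le_slopeWeight {θ : GraphPar n m} (hθ : ∀ i j, |(θ i).1 j| ≤ 2) :
    (exp (-2) ^ n) ^ m ≤ slopeWeight θ := by
  have e : (exp (-2) ^ n) ^ m = ∏ _i : Fin m, ∏ _j : Fin n, exp (-2) := by simp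
  rw [e]
  refine Finset.prod_le_prod (fun _ _ => by positivity) fun i _ =>
    Finset.prod_le_prod (fun _ _ => by positivity) fun j _ => ?_
  gcongr
  have := sq_le_sq' (by linarith [abs_le.1 (hθ i j)]) (abs_le.1 (hθ i j)).2
  linarith

lemma sum_setIntegral_le_integral {X β : Type*} [MeasurableSpace X] {μ : Measure X} {f : X → ℝ}
    (hf : Integrable f μ) (hf0 : ∀ x, 0 ≤ f x) (V : Finset β) {B : β → Set X}
    (hB : ∀ a, MeasurableSet (B a)) (hd : (V : Set β).Pairwise fun a b => Disjoint (B a) (B b)) :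
    ∑ a ∈ V, ∫ x in B a, f x ∂μ ≤ ∫ x, f x ∂μ := by
  rw [← integral_biUnion_finset V (fun a _ => hB a) hd fun a _ => hf.integrableOn]
  exact setIntegral_le_integral hf (Filter.Eventually.of_forall hf0)

/-! ### The incidence bound for graphs -/

set_option maxHeartbeats 1000000 in
/-- Incidences between points and graphs, with a free intermediate scale `2 ^ L * δ`. -/
lemma exists_sum_card_le_of_scale (n m K : ℕ) (hK : n < 2 * K) {M c S : ℝ} (hc : 0 < c)
    (hc1 : c ≤ 1) (hS : 0 ≤ S) : ∃ C : ℝ, 0 ≤ C ∧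
    ∀ {α β : Type} (P : Finset α) (z : α → SplitPt n m) (V : Finset β) (θ : β → GraphPar n m)
      (δ F t : ℝ) (L : ℕ), 0 < δ → δ < 1 → 0 < F → (P.card : ℝ) ≤ F → m ≤ t → t ≤ n + m →
      (∀ r, δ ≤ r → ∀ x, ((P.filter fun p => dist (z p) x ≤ r).card : ℝ) ≤ F * r ^ t) →
      (∀ p ∈ P, ‖(z p).1‖ ≤ 1) → (∀ a ∈ V, ∀ i j, |(θ a i).1 j| ≤ 1) →
      ((V : Set β).Pairwise fun a b => c * δ ≤ dist (θ a) (θ b)) → 2 ^ (L + K) * δ ≤ S →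
      ∑ a ∈ V, ((P.filter fun p => ∀ i, |graphDisp (θ a) (z p) i| ≤ M * δ).card : ℝ) ≤
        C * (L + 1) ^ K * F * δ ^ m * (V.card * (2 ^ L * δ) ^ (t - (n + m)) +
          L * (2 ^ L * δ) ^ n * (δ ^ ((n + 1) * m))⁻¹) := by
  obtain ⟨C₁, hC₁, h₁⟩ := exists_sum_graphBump_le n m hS
  obtain ⟨C₂, hC₂, h₂⟩ := exists_integral_dilDiff_sq_le_of_card_ball_le n m hK
  obtain ⟨C₃, -, h₃⟩ := exists_integral_dilDiff_sq_le n m K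
  set v : ℝ := volume.real (Metric.ball (0 : GraphPar n m) 1) with hv
  have hv0 : 0 < v := ENNReal.toReal_pos
    (Metric.measure_ball_pos volume _ one_pos).ne' measure_ball_lt_top.ne
  set ρ : ℝ := (exp (-2) ^ n) ^ m with hρ
  have hρ0 : 0 < ρ := by positivity
  -- A parameter within `δ` of `θ a` adds at most `(n + 1) * δ` to the displacements, hence `M + (n
  -- + 1)`.
  set κ : ℝ := exp (-(M + (n + 1)) ^ 2 / 2) ^ m with hκ
  have hκ0 : 0 < κ := by positivity
  set q : ℝ := (c / 2) ^ ((n + 1) * m) * v with hq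
  have hq0 : 0 < q := by positivity
  refine ⟨κ⁻¹ * ((1 + 2 ^ K * C₁) + ρ⁻¹ * C₂ * q⁻¹), by positivity, ?_⟩
  intro α β P z V θ δ F t L hδ hδ1 hF hPF hmt htd hFr hz hθ hsep hLS
  set s₀ : ℝ := 2 ^ L * δ with hs₀
  have hs₀0 : 0 < s₀ := by positivity
  -- The size of the low part at scale `s₀`, used also as the threshold for the high part.
  set η : ℝ := F * s₀ ^ (t - (n + m)) with hη
  have hη0 : 0 < η := by positivity
  let u : GraphPar n m → ℝ → ℝ := fun ϑ τ => ∑ p ∈ P, graphBump τ ϑ (z p)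
  let w : ℕ → GraphPar n m → ℝ := fun i ϑ => dilDiff K (u ϑ) ((2 ^ i * δ) ^ 2)
  have hw_int : ∀ i, Integrable fun ϑ => w i ϑ ^ 2 * slopeWeight ϑ := fun i =>
    (h₃ P z (2 ^ i * δ) (by positivity)).1
  -- As `m ≤ t`, the power `s ^ (t - m)` increases with `s`, so the scale `s₀` dominates all finer
  -- ones.
  have hw_le : ∀ i < L, ∫ ϑ, w i ϑ ^ 2 * slopeWeight ϑ ≤ C₂ * (F * F * s₀ ^ (t - m)) := by
    intro i hi
    have hsi : 0 < 2 ^ i * δ := by positivity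
    have h1i : (1 : ℝ) ≤ 2 ^ i := one_le_pow₀ (by norm_num)
    refine (h₂ P z (2 ^ i * δ) (F * (2 ^ i * δ) ^ t) hsi
      (hFr _ (le_mul_of_one_le_left hδ.le h1i))).trans ?_
    refine mul_le_mul_of_nonneg_left ?_ hC₂
    have e : (2 ^ i * δ) ^ t * ((2 ^ i * δ) ^ m)⁻¹ = (2 ^ i * δ) ^ (t - m) := by
      rw [rpow_sub hsi, rpow_natCast, div_eq_mul_inv]
    calc P.card * (F * (2 ^ i * δ) ^ t) * ((2 ^ i * δ) ^ m)⁻¹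
        = P.card * F * ((2 ^ i * δ) ^ t * ((2 ^ i * δ) ^ m)⁻¹) := by ring
      _ ≤ F * F * s₀ ^ (t - m) := by
          rw [e]
          have h2 : 2 ^ i * δ ≤ s₀ := by
            rw [hs₀]
            gcongr
            norm_num
          have h3 : (2 ^ i * δ) ^ (t - m) ≤ s₀ ^ (t - m) :=
            rpow_le_rpow hsi.le h2 (by linarith)
          gcongr
  have hu0 : ∀ ϑ τ, 0 ≤ u ϑ τ := fun ϑ τ => Finset.sum_nonneg fun p _ => graphBump_nonneg _ _ _
  -- As `t ≤ n + m`, the power `s ^ (t - (n + m))` decreases with `s`, so the `K + 1` coarse scales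
  -- are all controlled by `s₀`.
  have hcoarse : ∀ ϑ : GraphPar n m, (∀ i j, |(ϑ i).1 j| ≤ 2) → ∀ j, L ≤ j → j ≤ L + K →
      |u ϑ (4 ^ j * δ ^ 2)| ≤ C₁ * η := by
    intro ϑ hϑ j hj hj'
    have hsj : 0 < 2 ^ j * δ := by positivity
    have h1j : (1 : ℝ) ≤ 2 ^ j := one_le_pow₀ (by norm_num)
    have e1 : (4 : ℝ) ^ j * δ ^ 2 = (2 ^ j * δ) ^ 2 := by
      rw [mul_pow, ← pow_mul, mul_comm j 2, pow_mul]
      norm_num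
    rw [abs_of_nonneg (hu0 _ _), e1]
    refine (h₁ P z (2 ^ j * δ) (F * (2 ^ j * δ) ^ t) hsj (le_trans ?_ hLS)
      (hFr _ (le_mul_of_one_le_left hδ.le h1j)) hz ϑ hϑ).trans ?_
    · gcongr
      norm_num
    · refine mul_le_mul_of_nonneg_left ?_ hC₁
      have e : (2 ^ j * δ) ^ t * ((2 ^ j * δ) ^ (n + m))⁻¹ = (2 ^ j * δ) ^ (t - (n + m)) := by
        rw [rpow_sub hsj, ← Nat.cast_add, rpow_natCast, div_eq_mul_inv]
      rw [mul_assoc, e, hη]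
      refine mul_le_mul_of_nonneg_left (rpow_le_rpow_of_nonpos hs₀0 ?_ (by linarith)) hF.le
      rw [hs₀]
      gcongr
      norm_num
  have hpt : ∀ ϑ : GraphPar n m, (∀ i j, |(ϑ i).1 j| ≤ 2) → u ϑ (δ ^ 2) ≤
      (L + 1) ^ K * ((1 + 2 ^ K * C₁) * η +
        (ρ * η)⁻¹ * ∑ i ∈ Finset.range L, w i ϑ ^ 2 * slopeWeight ϑ) := by
    intro ϑ hϑ
    have hρϑ := le_slopeWeight hϑ
    have hterm : ∀ i, 0 ≤ w i ϑ ^ 2 * slopeWeight ϑ := fun i =>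
      mul_nonneg (sq_nonneg _) (slopeWeight_pos _).le
    have hsum0 : 0 ≤ ∑ i ∈ Finset.range L, w i ϑ ^ 2 * slopeWeight ϑ :=
      Finset.sum_nonneg fun i _ => hterm i
    have h := abs_le_of_dilDiff_le (f := u ϑ) (τ := δ ^ 2) (T := C₁ * η) (L := L) (K := K)
      (W := η + (ρ * η)⁻¹ * ∑ i ∈ Finset.range L, w i ϑ ^ 2 * slopeWeight ϑ) (by positivity)
      (fun i hi => by
        have e1 : (4 : ℝ) ^ i * δ ^ 2 = (2 ^ i * δ) ^ 2 := by
          rw [mul_pow, ← pow_mul, mul_comm i 2, pow_mul]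
          norm_num
        rw [e1]
        change |w i ϑ| ≤ _
        have h3 : w i ϑ ^ 2 * slopeWeight ϑ ≤
            ∑ i ∈ Finset.range L, w i ϑ ^ 2 * slopeWeight ϑ :=
          Finset.single_le_sum (f := fun i => w i ϑ ^ 2 * slopeWeight ϑ) (fun i _ => hterm i)
            (Finset.mem_range.2 hi)
        have h4 : w i ϑ ^ 2 * ρ ≤ w i ϑ ^ 2 * slopeWeight ϑ := by gcongr
        -- This inequality makes the high part quadratic, ready for the `L²` bound after integration
        -- in `ϑ`.
        have h5 : |w i ϑ| ≤ η + η⁻¹ * w i ϑ ^ 2 := by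
          have : 0 ≤ η⁻¹ * (|w i ϑ| - η) ^ 2 := by positivity
          have e : η⁻¹ * (|w i ϑ| - η) ^ 2 = η⁻¹ * w i ϑ ^ 2 - 2 * |w i ϑ| + η := by
            rw [sub_sq, sq_abs]
            field_simp
          rw [e] at this
          linarith [abs_nonneg (w i ϑ)]
        calc |w i ϑ| ≤ η + η⁻¹ * w i ϑ ^ 2 := h5
          _ = η + (ρ * η)⁻¹ * (w i ϑ ^ 2 * ρ) := by field_simp
          _ ≤ _ := by gcongr; exact h4.trans h3)
      (hcoarse ϑ hϑ)
    rw [abs_of_nonneg (hu0 _ _)] at h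
    refine h.trans (le_of_eq ?_)
    ring
  -- Separation makes these balls disjoint, so the sum over `V` of the local integrals is at most
  -- the integral over all graphs.
  let B : β → Set (GraphPar n m) := fun a => Metric.ball (θ a) (c / 2 * δ)
  have hBm : ∀ a, MeasurableSet (B a) := fun a => Metric.isOpen_ball.measurableSet
  have hBd : (V : Set β).Pairwise fun a b => Disjoint (B a) (B b) := fun a ha b hb hab =>
    Metric.ball_disjoint_ball (by linarith [hsep ha hb hab])
  have hBv : ∀ a, volume.real (B a) = q * δ ^ ((n + 1) * m) := fun a => by
    rw [volume_real_ball_graphPar _ (by positivity), mul_pow, hq]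
    ring
  have hBθ : ∀ a ∈ V, ∀ ϑ ∈ B a, ∀ i j, |(ϑ i).1 j| ≤ 2 := by
    intro a ha ϑ hϑ i j
    have h1 := abs_slope_sub_le ϑ (θ a) i j
    have h2 := abs_sub_abs_le_abs_sub ((ϑ i).1 j) ((θ a i).1 j)
    have h3 : dist ϑ (θ a) < c / 2 * δ := hϑ
    have h4 : c / 2 * δ ≤ 1 := mul_le_one₀ (by linarith) hδ.le hδ1.le
    linarith [hθ a ha i j]
  let N : β → ℝ := fun a => ((P.filter fun p => ∀ i, |graphDisp (θ a) (z p) i| ≤ M * δ).card : ℝ)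
  have hlow : ∀ a, ∀ ϑ ∈ B a, κ * (δ ^ m)⁻¹ * N a ≤ u ϑ (δ ^ 2) := by
    intro a ϑ hϑ
    calc κ * (δ ^ m)⁻¹ * N a
        = ∑ p ∈ P.filter fun p => ∀ i, |graphDisp (θ a) (z p) i| ≤ M * δ, κ * (δ ^ m)⁻¹ := by
          rw [Finset.sum_const, nsmul_eq_mul, mul_comm]
      _ ≤ ∑ p ∈ P.filter fun p => ∀ i, |graphDisp (θ a) (z p) i| ≤ M * δ,
            graphBump (δ ^ 2) ϑ (z p) := by
          refine Finset.sum_le_sum fun p hp => le_graphBump hδ fun i => ?_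
          rw [Finset.mem_filter] at hp
          have h1 := abs_graphDisp_sub_le (θ a) ϑ (hz p hp.1) i
          have h2 : dist (θ a) ϑ ≤ δ := by
            rw [dist_comm]
            have h3 : dist ϑ (θ a) < c / 2 * δ := hϑ
            have h4 : c / 2 * δ ≤ δ := mul_le_of_le_one_left hδ.le (by linarith)
            linarith
          have h3 := abs_sub_abs_le_abs_sub (graphDisp ϑ (z p) i) (graphDisp (θ a) (z p) i)
          have h4 : ((n : ℝ) + 1) * dist (θ a) ϑ ≤ (n + 1) * δ := by gcongr
          linarith [hp.2 i]
      _ ≤ u ϑ (δ ^ 2) := Finset.sum_le_sum_of_subset_of_nonneg (Finset.filter_subset _ _)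
          fun p _ _ => graphBump_nonneg _ _ _
  have hint : ∀ a ∈ V, q * δ ^ ((n + 1) * m) * (κ * (δ ^ m)⁻¹ * N a) ≤
      (L + 1) ^ K * (q * δ ^ ((n + 1) * m) * ((1 + 2 ^ K * C₁) * η) +
        (ρ * η)⁻¹ * ∑ i ∈ Finset.range L, ∫ ϑ in B a, w i ϑ ^ 2 * slopeWeight ϑ) := by
    intro a ha
    have hfin : volume (B a) ≠ ∞ := measure_ball_lt_top.ne
    have hI1 : IntegrableOn (fun _ : GraphPar n m => (1 + 2 ^ K * C₁) * η) (B a) :=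
      integrableOn_const hfin
    have hI2 : IntegrableOn (fun ϑ : GraphPar n m =>
        (ρ * η)⁻¹ * ∑ i ∈ Finset.range L, w i ϑ ^ 2 * slopeWeight ϑ) (B a) :=
      ((integrable_finsetSum _ fun i _ => hw_int i).const_mul _).integrableOn
    have h1 : ∫ ϑ in B a, κ * (δ ^ m)⁻¹ * N a ≤ ∫ ϑ in B a, (L + 1) ^ K *
        ((1 + 2 ^ K * C₁) * η +
          (ρ * η)⁻¹ * ∑ i ∈ Finset.range L, w i ϑ ^ 2 * slopeWeight ϑ) :=
      setIntegral_mono_on (integrableOn_const hfin) ((hI1.add hI2).const_mul _) (hBm a)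
        fun ϑ hϑ => (hlow a ϑ hϑ).trans (hpt ϑ (hBθ a ha ϑ hϑ))
    rw [setIntegral_const, hBv, smul_eq_mul, integral_const_mul, integral_add hI1 hI2,
      setIntegral_const, hBv, smul_eq_mul, integral_const_mul,
      integral_finsetSum _ fun i _ => (hw_int i).integrableOn] at h1
    exact h1
  have hsumw : ∑ a ∈ V, ∑ i ∈ Finset.range L, ∫ ϑ in B a, w i ϑ ^ 2 * slopeWeight ϑ ≤
      L * (C₂ * (F * F * s₀ ^ (t - m))) := by
    rw [Finset.sum_comm]
    calc _ ≤ ∑ _i ∈ Finset.range L, C₂ * (F * F * s₀ ^ (t - m)) :=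
          Finset.sum_le_sum fun i hi => (sum_setIntegral_le_integral (hw_int i)
            (fun ϑ => mul_nonneg (sq_nonneg _) (slopeWeight_pos _).le) V hBm hBd).trans
            (hw_le i (Finset.mem_range.1 hi))
      _ = _ := by simp
  have htotal : q * δ ^ ((n + 1) * m) * (κ * (δ ^ m)⁻¹ * ∑ a ∈ V, N a) ≤
      (L + 1) ^ K * (V.card * (q * δ ^ ((n + 1) * m) * ((1 + 2 ^ K * C₁) * η)) +
        (ρ * η)⁻¹ * (L * (C₂ * (F * F * s₀ ^ (t - m))))) := by
    calc _ = ∑ a ∈ V, q * δ ^ ((n + 1) * m) * (κ * (δ ^ m)⁻¹ * N a) := by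
          rw [Finset.mul_sum, Finset.mul_sum]
      _ ≤ ∑ a ∈ V, (L + 1) ^ K * (q * δ ^ ((n + 1) * m) * ((1 + 2 ^ K * C₁) * η) +
          (ρ * η)⁻¹ * ∑ i ∈ Finset.range L, ∫ ϑ in B a, w i ϑ ^ 2 * slopeWeight ϑ) :=
          Finset.sum_le_sum hint
      _ = (L + 1) ^ K * (V.card * (q * δ ^ ((n + 1) * m) * ((1 + 2 ^ K * C₁) * η)) +
          (ρ * η)⁻¹ * ∑ a ∈ V, ∑ i ∈ Finset.range L,
            ∫ ϑ in B a, w i ϑ ^ 2 * slopeWeight ϑ) := by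
          rw [← Finset.mul_sum, Finset.sum_add_distrib, Finset.sum_const, nsmul_eq_mul,
            Finset.mul_sum _ _ (ρ * η)⁻¹]
      _ ≤ _ := by gcongr
  -- With this threshold the high part is linear in `F`, like the low part.
  have hη2 : η⁻¹ * (F * F * s₀ ^ (t - m)) = F * s₀ ^ n := by
    have e : s₀ ^ (t - m) = s₀ ^ (t - (n + m)) * s₀ ^ n := by
      rw [← rpow_natCast s₀ n, ← rpow_add hs₀0]
      congr 1
      ring
    rw [e, hη]
    field_simp
  have hfac : 0 < q * δ ^ ((n + 1) * m) * (κ * (δ ^ m)⁻¹) := by positivity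
  rw [← mul_assoc, ← le_div_iff₀' hfac] at htotal
  refine htotal.trans ?_
  have e1 : (ρ * η)⁻¹ * (L * (C₂ * (F * F * s₀ ^ (t - m)))) =
      ρ⁻¹ * C₂ * (L * (F * s₀ ^ n)) := by
    rw [← hη2, mul_inv]
    ring
  rw [e1, hη]
  have e2 : (L + 1 : ℝ) ^ K * (V.card * (q * δ ^ ((n + 1) * m) *
      ((1 + 2 ^ K * C₁) * (F * s₀ ^ (t - (n + m))))) + ρ⁻¹ * C₂ * (L * (F * s₀ ^ n))) /
      (q * δ ^ ((n + 1) * m) * (κ * (δ ^ m)⁻¹)) =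
      κ⁻¹ * (L + 1) ^ K * F * δ ^ m * ((1 + 2 ^ K * C₁) * (V.card * s₀ ^ (t - (n + m))) +
        ρ⁻¹ * C₂ * q⁻¹ * (L * s₀ ^ n * (δ ^ ((n + 1) * m))⁻¹)) := by
    field_simp
  rw [e2]
  have ha : 0 ≤ V.card * s₀ ^ (t - (n + m)) := by positivity
  have hb : 0 ≤ L * s₀ ^ n * (δ ^ ((n + 1) * m))⁻¹ := by positivity
  have hp : 0 ≤ 1 + 2 ^ K * C₁ := by positivity
  have hr : 0 ≤ ρ⁻¹ * C₂ * q⁻¹ := by positivity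
  calc _ ≤ κ⁻¹ * (L + 1) ^ K * F * δ ^ m * (((1 + 2 ^ K * C₁) + ρ⁻¹ * C₂ * q⁻¹) *
        (V.card * s₀ ^ (t - (n + m)) + L * s₀ ^ n * (δ ^ ((n + 1) * m))⁻¹)) := by
        refine mul_le_mul_of_nonneg_left ?_ (by positivity)
        nlinarith [mul_nonneg hp hb, mul_nonneg hr ha]
    _ = _ := by ring

/-! ### Choice of the intermediate scale -/

lemma exists_card_mul_pow_le (n m : ℕ) {c R : ℝ} (hc : 0 < c) (hc1 : c ≤ 1) (hR : 1 ≤ R) :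
    ∃ X : ℝ, 0 < X ∧ ∀ {β : Type} (V : Finset β) (θ : β → GraphPar n m) (δ : ℝ), 0 < δ → δ < 1 →
      (∀ a ∈ V, ‖θ a‖ ≤ R) → ((V : Set β).Pairwise fun a b => c * δ ≤ dist (θ a) (θ b)) →
      V.card * δ ^ ((n + 1) * m) ≤ X := by
  set v : ℝ := volume.real (Metric.ball (0 : GraphPar n m) 1) with hv
  have hv0 : 0 < v := ENNReal.toReal_pos
    (Metric.measure_ball_pos volume _ one_pos).ne' measure_ball_lt_top.ne
  set N := (n + 1) * m with hN
  refine ⟨((c / 2) ^ N)⁻¹ * (R + 1) ^ N, by positivity, fun V θ δ hδ hδ1 hθ hsep => ?_⟩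
  have hBd : (V : Set _).Pairwise fun a b =>
      Disjoint (Metric.ball (θ a) (c / 2 * δ)) (Metric.ball (θ b) (c / 2 * δ)) :=
    fun a ha b hb hab => Metric.ball_disjoint_ball (by linarith [hsep ha hb hab])
  have h1 : ∑ a ∈ V, volume.real (Metric.ball (θ a) (c / 2 * δ)) ≤
      volume.real (Metric.ball (0 : GraphPar n m) (R + 1)) := by
    rw [← measureReal_biUnion_finset hBd fun a _ => Metric.isOpen_ball.measurableSet]
    refine measureReal_mono ?_ measure_ball_lt_top.ne
    refine Set.iUnion₂_subset fun a ha => Metric.ball_subset_ball' ?_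
    rw [dist_zero_right]
    have h4 : c / 2 * δ ≤ 1 := mul_le_one₀ (by linarith) hδ.le hδ1.le
    linarith [hθ a ha]
  simp_rw [volume_real_ball_graphPar _ (show 0 < c / 2 * δ by positivity)] at h1
  rw [volume_real_ball_graphPar _ (show 0 < R + 1 by positivity), Finset.sum_const, nsmul_eq_mul, ← mul_assoc,
    ← hv, ← hN] at h1
  have h2 := le_of_mul_le_mul_right h1 hv0
  rw [mul_pow] at h2
  rw [inv_mul_eq_div, le_div_iff₀ (by positivity)]
  linarith

lemma exists_natCast_add_one_pow_le (k : ℕ) {ε : ℝ} (hε : 0 < ε) :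
    ∃ C : ℝ, 0 < C ∧ ∀ L : ℕ, (L + 1 : ℝ) ^ k ≤ C * (2 ^ L) ^ ε := by
  obtain ⟨C, hC, h⟩ := exists_one_add_rpow_le_exp k (c := log 2 * ε)
    (mul_pos (log_pos (by norm_num)) hε)
  refine ⟨C, hC, fun L => ?_⟩
  have h1 := h L (Nat.cast_nonneg L)
  rw [rpow_natCast, add_comm] at h1
  rw [rpow_def_of_pos (by positivity), log_pow]
  refine h1.trans (le_of_eq ?_)
  ring_nf

/-- The alternative `L = 0` covers `s ≤ δ`: there is then no scale to difference, and the high part,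
which carries a factor `L`, vanishes. -/
lemma exists_dyadic_scale {δ s : ℝ} (hδ : 0 < δ) :
    ∃ L : ℕ, (L = 0 ∨ 2 ^ L * δ ≤ s) ∧ s ≤ 2 * (2 ^ L * δ) := by
  rcases le_or_gt s δ with h | h
  · exact ⟨0, Or.inl rfl, by simp; linarith⟩
  · obtain ⟨L, h1, h2⟩ := exists_nat_pow_near (x := s / δ) (y := (2 : ℝ))
      ((one_le_div hδ).2 h.le) (by norm_num)
    refine ⟨L, Or.inr ((le_div_iff₀ hδ).1 h1), ?_⟩
    rw [div_lt_iff₀ hδ, pow_succ] at h2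
    linarith

/-- Incidence bound for points and graphs of affine maps. -/
lemma exists_sum_card_le (n m : ℕ) (hn : 0 < n) {M c R ε t : ℝ} (hc : 0 < c) (hc1 : c ≤ 1)
    (hR : 1 ≤ R) (hε : 0 < ε) (hmt : m ≤ t) (htd : t ≤ n + m) : ∃ C : ℝ, 0 ≤ C ∧
    ∀ {α β : Type} (P : Finset α) (z : α → SplitPt n m) (V : Finset β) (θ : β → GraphPar n m)
      (δ F : ℝ), 0 < δ → δ < 1 → 0 < F → (P.card : ℝ) ≤ F →
      (∀ r, δ ≤ r → ∀ x, ((P.filter fun p => dist (z p) x ≤ r).card : ℝ) ≤ F * r ^ t) →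
      (∀ p ∈ P, ‖(z p).1‖ ≤ 1) → (∀ a ∈ V, ∀ i j, |(θ a i).1 j| ≤ 1) →
      (∀ a ∈ V, ‖θ a‖ ≤ R) →
      ((V : Set β).Pairwise fun a b => c * δ ≤ dist (θ a) (θ b)) →
      ∑ a ∈ V, ((P.filter fun p => ∀ i, |graphDisp (θ a) (z p) i| ≤ M * δ).card : ℝ) ≤
        C * δ ^ (-ε) * F * (V.card : ℝ) ^ ((n : ℝ) / (2 * n + m - t)) *
          δ ^ ((n : ℝ) * (t + 1 - (n + m)) * m / (2 * n + m - t)) := by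
  have hn0 : (0 : ℝ) < n := by exact_mod_cast hn
  have hD : 0 < 2 * n + m - t := by linarith
  set D := 2 * n + m - t with hDdef
  obtain ⟨X, hX0, hX⟩ := exists_card_mul_pow_le n m hc hc1 hR
  -- `X ^ (1 / D)` bounds the balancing scale `s`; the summand `1` covers the case `L = 0`, where
  -- the scale is `δ`.
  set S := X ^ (1 / D) + 1 with hSdef
  have hS1 : 1 ≤ S := by linarith [rpow_nonneg hX0.le (1 / D)]
  -- `K = n` is admissible since `n < 2 * n`; the factor `2 ^ n` leaves room for the `K` scales
  -- above `s₀`.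
  obtain ⟨C₁, hC₁, h₁⟩ := exists_sum_card_le_of_scale n m n (by omega) (M := M) hc hc1
    (show 0 ≤ 2 ^ n * S by positivity)
  obtain ⟨C₂, hC₂, h₂⟩ := exists_natCast_add_one_pow_le (n + 1) hε
  refine ⟨C₁ * C₂ * S ^ ε * 2 ^ n, by positivity, ?_⟩
  intro α β P z V θ δ F hδ hδ1 hF hPF hFr hz hθ hθR hsep
  rcases V.eq_empty_or_nonempty with rfl | hV
  · simp only [Finset.sum_empty]
    positivity
  have hcard : (0 : ℝ) < V.card := by exact_mod_cast hV.card_pos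
  set N := (n + 1) * m with hN
  set Y : ℝ := V.card * δ ^ N with hY
  have hY0 : 0 < Y := by positivity
  have hYX : Y ≤ X := hX V θ δ hδ hδ1 hθR hsep
  -- The solution of `V.card * s ^ (t - (n + m)) = s ^ n * (δ ^ N)⁻¹`.
  set s : ℝ := Y ^ (1 / D) with hs
  have hs0 : 0 < s := by positivity
  have hsS : s + 1 ≤ S := by
    have : s ≤ X ^ (1 / D) := rpow_le_rpow hY0.le hYX (by positivity)
    linarith
  obtain ⟨L, hL, hL2⟩ := exists_dyadic_scale (s := s) hδ
  have hs₀0 : 0 < 2 ^ L * δ := by positivity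
  have hLS : 2 ^ L * δ ≤ S := by
    rcases hL with rfl | h
    · simp; linarith
    · linarith
  refine (h₁ P z V θ δ F t L hδ hδ1 hF hPF hmt htd hFr hz hθ hsep ?_).trans ?_
  · rw [pow_add]
    calc 2 ^ L * 2 ^ n * δ = 2 ^ n * (2 ^ L * δ) := by ring
      _ ≤ 2 ^ n * S := by gcongr
  have hsn : s ^ n = Y ^ (n / D) := by
    rw [hs, ← rpow_natCast, ← rpow_mul hY0.le]
    congr 1
    ring
  have hA : V.card * (2 ^ L * δ) ^ (t - (n + m)) ≤ 2 ^ n * (Y ^ (n / D) * (δ ^ N)⁻¹) := by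
    have e1 : (2 ^ L * δ) ^ (t - (n + m)) ≤ (s / 2) ^ (t - (n + m)) :=
      rpow_le_rpow_of_nonpos (by positivity) (by linarith) (by linarith)
    have e2 : (s / 2) ^ (t - (n + m)) = s ^ (t - (n + m)) * 2 ^ (n + m - t) := by
      rw [div_rpow hs0.le (by norm_num), div_eq_mul_inv, ← rpow_neg (by norm_num)]
      congr 2
      ring
    have e3 : (2 : ℝ) ^ (n + m - t) ≤ 2 ^ n := by
      rw [← rpow_natCast 2 n]
      exact rpow_le_rpow_of_exponent_le (by norm_num) (by linarith)
    have e4 : (V.card : ℝ) * s ^ (t - (n + m)) = Y ^ (n / D) * (δ ^ N)⁻¹ := by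
      have e5 : Y ^ (n / D) = Y * s ^ (t - (n + m)) := by
        rw [hs, ← rpow_mul hY0.le]
        nth_rewrite 2 [← rpow_one Y]
        rw [← rpow_add hY0]
        congr 1
        field_simp
        rw [hDdef]
        ring
      rw [e5, hY]
      field_simp
    calc V.card * (2 ^ L * δ) ^ (t - (n + m))
        ≤ V.card * (s ^ (t - (n + m)) * 2 ^ n) := by
          rw [e2] at e1
          gcongr
          exact e1.trans (by gcongr)
      _ = 2 ^ n * (V.card * s ^ (t - (n + m))) := by ring
      _ = _ := by rw [e4]
  have hB : L * (2 ^ L * δ) ^ n * (δ ^ N)⁻¹ ≤ L * (2 ^ n * (Y ^ (n / D) * (δ ^ N)⁻¹)) := by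
    rcases hL with rfl | h
    · simp
    · rw [← hsn, mul_assoc]
      have h3 : (2 ^ L * δ) ^ n ≤ s ^ n := by gcongr
      have h4 : (1 : ℝ) ≤ 2 ^ n := one_le_pow₀ (by norm_num)
      refine mul_le_mul_of_nonneg_left ?_ (Nat.cast_nonneg _)
      calc (2 ^ L * δ) ^ n * (δ ^ N)⁻¹ ≤ s ^ n * (δ ^ N)⁻¹ := by gcongr
        _ ≤ _ := le_mul_of_one_le_left (by positivity) h4
  have hlog : (L + 1 : ℝ) ^ (n + 1) ≤ C₂ * (S ^ ε * δ ^ (-ε)) := by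
    refine (h₂ L).trans ?_
    gcongr
    rw [rpow_neg hδ.le, ← div_eq_mul_inv, ← div_rpow (by positivity) hδ.le]
    gcongr
    rw [le_div_iff₀ hδ]
    exact hLS
  -- The exponent of `δ` is `m - N + N * n / D`; insert `N = (n + 1) * m` and `n - D = t - (n + m)`.
  have hfin : δ ^ m * (Y ^ (n / D) * (δ ^ N)⁻¹) = (V.card : ℝ) ^ (n / D) *
      δ ^ ((n : ℝ) * (t + 1 - (n + m)) * m / D) := by
    rw [hY, mul_rpow hcard.le (by positivity), ← rpow_natCast δ N, ← rpow_natCast δ m,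
      ← rpow_mul hδ.le, ← rpow_neg hδ.le]
    have : δ ^ ((n : ℝ) * (t + 1 - (n + m)) * m / D) =
        δ ^ (m : ℝ) * (δ ^ ((N : ℝ) * (n / D)) * δ ^ (-(N : ℝ))) := by
      rw [← rpow_add hδ, ← rpow_add hδ]
      congr 1
      rw [hN]
      push_cast
      field_simp
      rw [hDdef]
      ring
    rw [this]
    ring
  calc C₁ * (L + 1) ^ n * F * δ ^ m * (V.card * (2 ^ L * δ) ^ (t - (n + m)) +
          L * (2 ^ L * δ) ^ n * (δ ^ N)⁻¹)
      ≤ C₁ * (L + 1) ^ n * F * δ ^ m * (2 ^ n * (Y ^ (n / D) * (δ ^ N)⁻¹) +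
          L * (2 ^ n * (Y ^ (n / D) * (δ ^ N)⁻¹))) := by gcongr
    _ = C₁ * (L + 1) ^ (n + 1) * F * 2 ^ n * (δ ^ m * (Y ^ (n / D) * (δ ^ N)⁻¹)) := by ring
    _ ≤ C₁ * (C₂ * (S ^ ε * δ ^ (-ε))) * F * 2 ^ n *
          (δ ^ m * (Y ^ (n / D) * (δ ^ N)⁻¹)) := by gcongr
    _ = _ := by rw [hfin]; ring

end GraphIncidences

/-! ### Separated sets and covering numbers -/

lemma card_le_of_isDeltaSeparated {d : ℕ} {δ r : ℝ} (hδ : 0 < δ) (hr : 0 ≤ r)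
    (T : Finset (EuclideanSpace ℝ (Fin d))) (x : EuclideanSpace ℝ (Fin d))
    (hT : IsDeltaSeparated δ (T : Set (EuclideanSpace ℝ (Fin d))))
    (hTx : ∀ p ∈ T, dist p x ≤ r) : (T.card : ℝ) ≤ ((2 * r + δ) / δ) ^ d := by
  set v : ℝ := volume.real (Metric.ball (0 : EuclideanSpace ℝ (Fin d)) 1) with hv
  have hv0 : 0 < v := ENNReal.toReal_pos
    (Metric.measure_ball_pos volume _ one_pos).ne' measure_ball_lt_top.ne
  have hvol : ∀ (y : EuclideanSpace ℝ (Fin d)) (ρ : ℝ), 0 < ρ →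
      volume.real (Metric.ball y ρ) = ρ ^ d * v := by
    intro y ρ hρ
    rw [measureReal_def, Measure.addHaar_ball_of_pos volume y hρ, ENNReal.toReal_mul,
      ENNReal.toReal_ofReal (by positivity), hv, measureReal_def]
    simp
  have hd : (T : Set (EuclideanSpace ℝ (Fin d))).Pairwise fun a b =>
      Disjoint (Metric.ball a (δ / 2)) (Metric.ball b (δ / 2)) :=
    fun a ha b hb hab => Metric.ball_disjoint_ball (by linarith [hT ha hb hab])
  have h1 : ∑ a ∈ T, volume.real (Metric.ball a (δ / 2)) ≤
      volume.real (Metric.ball x (r + δ / 2)) := by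
    rw [← measureReal_biUnion_finset hd fun a _ => Metric.isOpen_ball.measurableSet]
    refine measureReal_mono ?_ measure_ball_lt_top.ne
    exact Set.iUnion₂_subset fun a ha => Metric.ball_subset_ball' (by linarith [hTx a ha])
  simp_rw [hvol _ _ (half_pos hδ)] at h1
  rw [hvol _ _ (by positivity), Finset.sum_const, nsmul_eq_mul, ← mul_assoc] at h1
  have h2 := le_of_mul_le_mul_right h1 hv0
  rw [← le_div_iff₀ (by positivity), ← div_pow] at h2
  refine h2.trans (le_of_eq ?_)
  congr 1
  field_simp

lemma encard_le_of_isDeltaSeparated {d N : ℕ} {δ r : ℝ} (hδ : 0 < δ) (hr : 0 ≤ r)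
    (hN : ((2 * r + δ) / δ) ^ d ≤ N) (T : Set (EuclideanSpace ℝ (Fin d)))
    (x : EuclideanSpace ℝ (Fin d)) (hT : IsDeltaSeparated δ T)
    (hTx : ∀ p ∈ T, dist p x ≤ r) : T.encard ≤ N := by
  by_contra! hlt
  obtain ⟨U, hU, hUc⟩ := Set.exists_subset_encard_eq (Order.add_one_le_of_lt hlt)
  have hfin : U.Finite := Set.finite_of_encard_eq_coe (k := N + 1) (by rw [hUc]; norm_cast)
  lift U to Finset (EuclideanSpace ℝ (Fin d)) using hfin
  rw [Set.encard_coe_eq_coe_finsetCard] at hUc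
  have hc : U.card = N + 1 := by exact_mod_cast hUc
  have := (card_le_of_isDeltaSeparated hδ hr U x (hT.mono hU) fun p hp => hTx p (hU hp)).trans hN
  rw [hc] at this
  push_cast at this
  linarith

/-- By packing, each `δ`-ball of a cover contains at most `((2 * δ + δ) / δ) ^ d = 3 ^ d` points of
a `δ`-separated set. -/
lemma encard_le_mul_externalCoveringNumber {d : ℕ} {δ : ℝ} (hδ : 0 < δ)
    (T : Set (EuclideanSpace ℝ (Fin d))) (hT : IsDeltaSeparated δ T) :
    T.encard ≤ ((3 ^ d : ℕ) : ℕ∞) * Metric.externalCoveringNumber δ.toNNReal T := by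
  have key : ∀ C : Set (EuclideanSpace ℝ (Fin d)), Metric.IsCover δ.toNNReal T C →
      T.encard ≤ ((3 ^ d : ℕ) : ℕ∞) * C.encard := by
    intro C hC
    rcases C.finite_or_infinite with hfin | hinf
    · lift C to Finset (EuclideanSpace ℝ (Fin d)) using hfin
      have hsub : T ⊆ ⋃ c ∈ C, T ∩ Metric.closedBall c δ := by
        intro p hp
        obtain ⟨c, hc, hpc⟩ := hC hp
        have hpc' : edist p c ≤ δ.toNNReal := hpc
        refine Set.mem_iUnion₂.2 ⟨c, hc, hp, ?_⟩
        rw [edist_nndist, ENNReal.coe_le_coe] at hpc'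
        have h3 : dist p c ≤ (δ.toNNReal : ℝ) := hpc'
        rwa [Real.coe_toNNReal _ hδ.le] at h3
      calc T.encard ≤ (⋃ c ∈ C, T ∩ Metric.closedBall c δ).encard := Set.encard_le_encard hsub
        _ ≤ ∑ c ∈ C, (T ∩ Metric.closedBall c δ).encard :=
            Finset.induction_on C (by simp) fun c D hc ih => by
              rw [Finset.set_biUnion_insert, Finset.sum_insert hc]
              exact (Set.encard_union_le _ _).trans (by gcongr)
        _ ≤ ∑ _c ∈ C, ((3 ^ d : ℕ) : ℕ∞) := by
            refine Finset.sum_le_sum fun c _ => encard_le_of_isDeltaSeparated hδ hδ.le ?_ _ c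
              (hT.mono Set.inter_subset_left) fun p hp => hp.2
            rw [show (2 * δ + δ) / δ = 3 by field_simp; norm_num]
            push_cast
            rfl
        _ = _ := by
            rw [Finset.sum_const, nsmul_eq_mul, Set.encard_coe_eq_coe_finsetCard, mul_comm]
    · rw [hinf.encard_eq, ENat.mul_top (by positivity)]
      exact le_top
  by_cases htop : Metric.externalCoveringNumber δ.toNNReal T = ⊤
  · rw [htop, ENat.mul_top (by positivity)]
    exact le_top
  · have : Nonempty {C : Set (EuclideanSpace ℝ (Fin d)) // Metric.IsCover δ.toNNReal T C} :=
      ⟨⟨T, by simp⟩⟩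
    obtain ⟨C, hC⟩ := ENat.exists_eq_iInf
      fun C : {C : Set (EuclideanSpace ℝ (Fin d)) // Metric.IsCover δ.toNNReal T C} =>
        (C : Set (EuclideanSpace ℝ (Fin d))).encard
    have : Metric.externalCoveringNumber δ.toNNReal T =
        (C : Set (EuclideanSpace ℝ (Fin d))).encard := by
      rw [hC, Metric.externalCoveringNumber, iInf_subtype']
    rw [this]
    exact key C C.2

/-- A separated `(δ,t)`-set has few points in every ball of radius at least `δ`. -/
lemma card_ball_le_of_isDeltaSet {d : ℕ} {δ t C_F : ℝ} (hδ : 0 < δ) (ht : 0 < t)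
    (htd : t ≤ d) (hC : 1 ≤ C_F) (P : Finset (EuclideanSpace ℝ (Fin d)))
    (hsep : IsDeltaSeparated δ (P : Set (EuclideanSpace ℝ (Fin d))))
    (hP : IsDeltaSet δ t C_F (P : Set (EuclideanSpace ℝ (Fin d)))) {r : ℝ} (hr : δ ≤ r)
    (x : EuclideanSpace ℝ (Fin d)) :
    ((P.filter fun p => dist p x ≤ r).card : ℝ) ≤ (3 ^ d * 2 ^ d * (C_F * P.card)) * r ^ t := by
  have hr0 : 0 < r := hδ.trans_le hr
  have h2t : (2 : ℝ) ^ t ≤ 2 ^ d := by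
    rw [← rpow_natCast 2 d]
    exact rpow_le_rpow_of_exponent_le (by norm_num) htd
  -- The hypothesis is strict, `δ < r < 1`, so it is used at radius `2 * r`, which admits `r = δ`.
  -- If `2 * r ≥ 1` the bound is trivial, since `(2 * r) ^ t ≥ 1`.
  rcases lt_or_ge (2 * r) 1 with h | h
  · have h1 := hP.2 (2 * r) (by linarith) h x
    have h2 : ((P.filter fun p => dist p x ≤ r).card : ℝ≥0∞) ≤
        (3 ^ d : ℕ) * deltaCov δ ((P : Set _) ∩ Metric.closedBall x (2 * r)) := by
      have h3 := encard_le_mul_externalCoveringNumber hδ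
        ((P : Set _) ∩ Metric.closedBall x (2 * r)) (hsep.mono Set.inter_subset_left)
      have h4 : ((P.filter fun p => dist p x ≤ r : Finset (EuclideanSpace ℝ (Fin d))) :
          Set (EuclideanSpace ℝ (Fin d))).encard ≤
          ((P : Set _) ∩ Metric.closedBall x (2 * r)).encard := by
        refine Set.encard_le_encard fun p hp => ?_
        rw [Finset.mem_coe, Finset.mem_filter] at hp
        exact ⟨hp.1, by rw [Metric.mem_closedBall]; linarith [hp.2]⟩
      rw [Set.encard_coe_eq_coe_finsetCard] at h4
      have h5 := ENat.toENNReal_le.2 (h4.trans h3)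
      rw [ENat.toENNReal_mul] at h5
      exact h5
    have h6 : deltaCov δ (P : Set (EuclideanSpace ℝ (Fin d))) ≤ ENNReal.ofReal P.card := by
      have := Metric.externalCoveringNumber_le_encard_self (ε := δ.toNNReal)
        (P : Set (EuclideanSpace ℝ (Fin d)))
      rw [Set.encard_coe_eq_coe_finsetCard] at this
      rw [ENNReal.ofReal_natCast]
      exact ENat.toENNReal_le.2 this
    have h7 : ((P.filter fun p => dist p x ≤ r).card : ℝ≥0∞) ≤
        ENNReal.ofReal (3 ^ d * (C_F * P.card * (2 * r) ^ t)) := by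
      refine h2.trans ?_
      rw [ENNReal.ofReal_mul (by positivity), ENNReal.ofReal_mul (by positivity),
        ENNReal.ofReal_mul (by positivity)]
      gcongr
      · rw [← ENNReal.ofReal_natCast]
        push_cast
        exact le_rfl
      · exact h1.trans (by gcongr)
    rw [← ENNReal.ofReal_natCast, ENNReal.ofReal_le_ofReal_iff (by positivity)] at h7
    refine h7.trans ?_
    rw [mul_rpow (by norm_num) hr0.le]
    calc 3 ^ d * (C_F * P.card * (2 ^ t * r ^ t)) ≤ 3 ^ d * (C_F * P.card * (2 ^ d * r ^ t)) := by
          gcongr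
      _ = _ := by ring
  · have h1 : ((P.filter fun p => dist p x ≤ r).card : ℝ) ≤ P.card := by
      exact_mod_cast Finset.card_filter_le _ _
    have h2 : 1 ≤ (2 * r) ^ t := one_le_rpow h ht.le
    have h3 : (1 : ℝ) ≤ 3 ^ d := one_le_pow₀ (by norm_num)
    rw [mul_rpow (by norm_num) hr0.le] at h2
    calc ((P.filter fun p => dist p x ≤ r).card : ℝ) ≤ 1 * (1 * P.card) * 1 := by simpa using h1
      _ ≤ 3 ^ d * (C_F * P.card) * (2 ^ t * r ^ t) := by gcongr
      _ ≤ 3 ^ d * (C_F * P.card) * (2 ^ d * r ^ t) := by gcongr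
      _ = _ := by ring

/-! ### Planes as graphs with bounded slopes -/

/-- Extending an injection `Fin n → Fin (n + m)` to a splitting of the coordinates. -/
lemma exists_equiv_sum_of_injective {n m : ℕ} {f : Fin n → Fin (n + m)}
    (hf : Function.Injective f) :
    ∃ e : Fin n ⊕ Fin m ≃ Fin (n + m), ∀ j, e (Sum.inl j) = f j := by
  classical
  have hcard : Fintype.card {k // k ∉ Set.range f} = m := by
    rw [Fintype.card_subtype_compl, Fintype.card_fin]
    have : Fintype.card {k // k ∈ Set.range f} = n := by
      rw [← Fintype.card_congr (Equiv.ofInjective f hf), Fintype.card_fin]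
    rw [this]
    omega
  refine ⟨((Equiv.ofInjective f hf).sumCongr (Fintype.equivFinOfCardEq hcard).symm).trans
    (Equiv.sumCompl (· ∈ Set.range f)), fun j => ?_⟩
  simp

/-- Every `n`-dimensional subspace is a graph with slopes at most `1` over a suitable choice of
`n` coordinates. -/
lemma exists_graph_of_finrank_eq {n m : ℕ}
    (U : Submodule ℝ (EuclideanSpace ℝ (Fin (n + m)))) (hU : Module.finrank ℝ U = n) :
    ∃ (e : Fin n ⊕ Fin m ≃ Fin (n + m)) (A : Fin m → Fin n → ℝ), (∀ i j, |A i j| ≤ 1) ∧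
      ∀ v ∈ U, ∀ i, v (e (Sum.inr i)) = ∑ j, A i j * v (e (Sum.inl j)) := by
  classical
  let φ : Fin (n + m) → Module.Dual ℝ U := fun k =>
    (EuclideanSpace.proj k : EuclideanSpace ℝ (Fin (n + m)) →L[ℝ] ℝ).toLinearMap ∘ₗ U.subtype
  have hφ : ∀ k (v : U), φ k v = (v : EuclideanSpace ℝ (Fin (n + m))) k := fun k v => rfl
  -- A vector on which all coordinates vanish is zero, so the coordinate functionals span the dual
  -- of `U`.
  have hspan : Submodule.span ℝ (Set.range φ) = ⊤ := by
    rw [← Subspace.dualCoannihilator_dualAnnihilator_eq (W := Submodule.span ℝ (Set.range φ)),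
      ← Submodule.dualAnnihilator_bot]
    congr 1
    rw [eq_bot_iff]
    intro v hv
    rw [Submodule.mem_dualCoannihilator] at hv
    rw [Submodule.mem_bot]
    ext k
    exact hv (φ k) (Submodule.subset_span ⟨k, rfl⟩)
  have hfr : Module.finrank ℝ (Module.Dual ℝ U) = n := by rw [Subspace.dual_finrank_eq, hU]
  let b : Module.Basis (Fin n) ℝ (Module.Dual ℝ U) := Module.finBasisOfFinrankEq _ _ hfr
  obtain ⟨f₀, hf₀⟩ : ∃ f : Fin n → Fin (n + m), b.det (φ ∘ f) ≠ 0 := by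
    obtain ⟨κ, a, ha, hsp, hli⟩ := exists_linearIndependent' ℝ φ
    rw [hspan] at hsp
    let bκ : Module.Basis κ ℝ (Module.Dual ℝ U) := Module.Basis.mk hli hsp.ge
    let g : Fin n ≃ κ := b.indexEquiv bκ
    refine ⟨a ∘ g, ?_⟩
    rw [← isUnit_iff_ne_zero, ← Module.Basis.is_basis_iff_det]
    refine ⟨hli.comp g g.injective, ?_⟩
    rw [← Function.comp_assoc, Set.range_comp, g.range_eq_univ, Set.image_univ, hsp]
  -- The `n` coordinates are chosen to maximise the absolute determinant.
  obtain ⟨f, -, hf⟩ := Finset.exists_max_image (Finset.univ : Finset (Fin n → Fin (n + m)))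
    (fun f => |b.det (φ ∘ f)|) ⟨f₀, Finset.mem_univ _⟩
  have hf0 : 0 < |b.det (φ ∘ f)| := (abs_pos.2 hf₀).trans_le (hf f₀ (Finset.mem_univ _))
  obtain ⟨hli, hsp⟩ := (Module.Basis.is_basis_iff_det b).2 (isUnit_iff_ne_zero.2 (abs_pos.1 hf0))
  have hinj : Function.Injective f := Function.Injective.of_comp (f := φ) hli.injective
  obtain ⟨e, he⟩ := exists_equiv_sum_of_injective hinj
  let bf : Module.Basis (Fin n) ℝ (Module.Dual ℝ U) := Module.Basis.mk hli hsp.ge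
  refine ⟨e, fun i j => bf.coord j (φ (e (Sum.inr i))), fun i j => ?_, fun v hv i => ?_⟩
  -- Cramer's rule: a slope is the quotient of the determinant with one functional replaced by the
  -- maximal one, hence at most `1` in absolute value.
  · have h1 := congrArg (fun ψ => ψ (φ (e (Sum.inr i))))
      (b.det_smul_mk_coord_eq_det_update hli hsp.ge j)
    simp only [LinearMap.smul_apply, smul_eq_mul, MultilinearMap.toLinearMap_apply,
      AlternatingMap.coe_multilinearMap] at h1
    rw [← Function.comp_update] at h1
    have h2 := hf (Function.update f j (e (Sum.inr i))) (Finset.mem_univ _)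
    rw [← h1, abs_mul] at h2
    exact le_of_mul_le_mul_left (by rw [mul_one]; exact h2) hf0
  · have h1 := congrArg (fun ψ : Module.Dual ℝ U => ψ ⟨v, hv⟩) (bf.sum_repr (φ (e (Sum.inr i))))
    simp only [LinearMap.sum_apply, LinearMap.smul_apply, smul_eq_mul] at h1
    rw [hφ] at h1
    rw [← h1]
    refine Finset.sum_congr rfl fun j _ => ?_
    simp only [bf, Module.Basis.mk_apply, Function.comp, hφ, he, Module.Basis.coord_apply]

/-! ### Comparison of the metric on planes with graph parameters -/

section GraphCharts

variable {n m : ℕ}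

/-- Splitting the coordinates of a point. -/
def splitCoord (e : Fin n ⊕ Fin m ≃ Fin (n + m)) (x : EuclideanSpace ℝ (Fin (n + m))) :
    SplitPt n m :=
  (fun j => x (e (Sum.inl j)), fun i => x (e (Sum.inr i)))

lemma EuclideanSpace.norm_le_of_forall_abs_le {N : ℕ} {x : EuclideanSpace ℝ (Fin N)} {B : ℝ}
    (hB : 0 ≤ B) (h : ∀ k, |x k| ≤ B) : ‖x‖ ≤ N * B := by
  rw [EuclideanSpace.norm_eq]
  refine sqrt_le_iff.2 ⟨by positivity, ?_⟩
  calc ∑ k, ‖x k‖ ^ 2 ≤ ∑ _k : Fin N, B ^ 2 :=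
        Finset.sum_le_sum fun k _ => pow_le_pow_left₀ (norm_nonneg _) (h k) 2
    _ = N * B ^ 2 := by simp
    _ ≤ (N * B) ^ 2 := by
        rw [mul_pow]
        gcongr
        rcases Nat.eq_zero_or_pos N with rfl | hN
        · simp
        · have : (1 : ℝ) ≤ N := by exact_mod_cast hN
          nlinarith

lemma EuclideanSpace.abs_apply_le_norm {N : ℕ} (x : EuclideanSpace ℝ (Fin N)) (k : Fin N) :
    |x k| ≤ ‖x‖ := PiLp.norm_apply_le x k

lemma norm_le_of_splitCoord (e : Fin n ⊕ Fin m ≃ Fin (n + m))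
    {x : EuclideanSpace ℝ (Fin (n + m))} {B : ℝ} (hB : 0 ≤ B)
    (h1 : ∀ j, |x (e (Sum.inl j))| ≤ B) (h2 : ∀ i, |x (e (Sum.inr i))| ≤ B) :
    ‖x‖ ≤ (n + m) * B := by
  have h : ∀ k, |x k| ≤ B := by
    intro k
    obtain ⟨k, rfl⟩ := e.surjective k
    rcases k with j | i
    exacts [h1 j, h2 i]
  have := EuclideanSpace.norm_le_of_forall_abs_le hB h
  push_cast at this
  exact this

/-- The plane `V` is the graph with parameter `θ`, with slopes at most `1`, in the coordinates
split by `e`. -/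
def IsGraphOf (e : Fin n ⊕ Fin m ≃ Fin (n + m)) (V : AffGrass (n + m) n) (θ : GraphPar n m) :
    Prop :=
  (∀ i j, |(θ i).1 j| ≤ 1) ∧ ∀ x ∈ V.plane, ∀ i, graphDisp θ (splitCoord e x) i = 0

lemma exists_isGraphOf (V : AffGrass (n + m) n) : ∃ e θ, IsGraphOf e V θ := by
  obtain ⟨e, A, hA, h⟩ := exists_graph_of_finrank_eq (m := m) V.plane.direction
    V.finrank_direction
  refine ⟨e, fun i => (A i, V.foot (e (Sum.inr i)) - ∑ j, A i j * V.foot (e (Sum.inl j))), hA,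
    fun x hx i => ?_⟩
  have h1 := h _ (AffineSubspace.vsub_mem_direction hx V.foot_mem) i
  simp only [vsub_eq_sub, PiLp.sub_apply, mul_sub, Finset.sum_sub_distrib] at h1
  simp only [graphDisp, splitCoord]
  linarith

variable {e : Fin n ⊕ Fin m ≃ Fin (n + m)} {V W : AffGrass (n + m) n} {θ θ' : GraphPar n m}

lemma IsGraphOf.apply_eq (h : IsGraphOf e V θ) {x : EuclideanSpace ℝ (Fin (n + m))}
    (hx : x ∈ V.plane) (i : Fin m) :
    x (e (Sum.inr i)) = ∑ j, (θ i).1 j * x (e (Sum.inl j)) + (θ i).2 := by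
  have := h.2 x hx i
  simp only [graphDisp, splitCoord] at this
  linarith

lemma IsGraphOf.direction_apply_eq (h : IsGraphOf e V θ) {v : EuclideanSpace ℝ (Fin (n + m))}
    (hv : v ∈ V.plane.direction) (i : Fin m) :
    v (e (Sum.inr i)) = ∑ j, (θ i).1 j * v (e (Sum.inl j)) := by
  have h1 := h.apply_eq (AffineSubspace.vadd_mem_of_mem_direction hv V.foot_mem) i
  have h2 := h.apply_eq V.foot_mem i
  simp only [vadd_eq_add, PiLp.add_apply, mul_add, Finset.sum_add_distrib] at h1
  linarith

/-- `IsGraphOf` only asks for containment in the graph. The base coordinates determine a direction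
vector, and equality of dimensions turns this injectivity into surjectivity. -/
lemma IsGraphOf.exists_mem_direction (h : IsGraphOf e V θ) (c : Fin n → ℝ) :
    ∃ v ∈ V.plane.direction, ∀ j, v (e (Sum.inl j)) = c j := by
  let f : V.plane.direction →ₗ[ℝ] (Fin n → ℝ) :=
    { toFun := fun v j => (v : EuclideanSpace ℝ (Fin (n + m))) (e (Sum.inl j))
      map_add' := fun v w => by ext j; simp
      map_smul' := fun r v => by ext j; simp }
  have hf : ∀ v j, f v j = (v : EuclideanSpace ℝ (Fin (n + m))) (e (Sum.inl j)) :=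
    fun _ _ => rfl
  have hinj : Function.Injective f := by
    rw [injective_iff_map_eq_zero]
    intro v hv
    have h0 : ∀ j, (v : EuclideanSpace ℝ (Fin (n + m))) (e (Sum.inl j)) = 0 := fun j => by
      rw [← hf, hv, Pi.zero_apply]
    ext k
    obtain ⟨k, rfl⟩ := e.surjective k
    rcases k with j | i
    · simpa using h0 j
    · rw [h.direction_apply_eq v.2 i]
      simp [h0]
  have hsurj : Function.Surjective f :=
    (LinearMap.injective_iff_surjective_of_finrank_eq_finrank
      (by rw [V.finrank_direction]; simp)).1 hinj
  obtain ⟨v, hv⟩ := hsurj c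
  exact ⟨v, v.2, fun j => by rw [← hv, hf]⟩

lemma abs_sum_slope_sub_mul_le (θ θ' : GraphPar n m) (e : Fin n ⊕ Fin m ≃ Fin (n + m))
    (x : EuclideanSpace ℝ (Fin (n + m))) (i : Fin m) :
    |∑ j, ((θ i).1 j - (θ' i).1 j) * x (e (Sum.inl j))| ≤ n * dist θ θ' * ‖x‖ := by
  refine (Finset.abs_sum_le_sum_abs _ _).trans ?_
  calc ∑ j, |((θ i).1 j - (θ' i).1 j) * x (e (Sum.inl j))|
      ≤ ∑ _j : Fin n, dist θ θ' * ‖x‖ := by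
        refine Finset.sum_le_sum fun j _ => ?_
        rw [abs_mul]
        exact mul_le_mul (abs_slope_sub_le θ θ' i j) (EuclideanSpace.abs_apply_le_norm x _)
          (abs_nonneg _) dist_nonneg
    _ = n * dist θ θ' * ‖x‖ := by simp; ring

lemma IsGraphOf.exists_direction_near (hV : IsGraphOf e V θ) (hW : IsGraphOf e W θ')
    {v : EuclideanSpace ℝ (Fin (n + m))} (hv : v ∈ V.plane.direction) :
    ∃ w ∈ W.plane.direction, ‖v - w‖ ≤ (n + m) * n * dist θ θ' * ‖v‖ := by
  obtain ⟨w, hw, hwv⟩ := hW.exists_mem_direction fun j => v (e (Sum.inl j))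
  refine ⟨w, hw, ?_⟩
  have := norm_le_of_splitCoord e (x := v - w) (B := n * dist θ θ' * ‖v‖) (by positivity)
    (fun j => by rw [PiLp.sub_apply, hwv, sub_self, abs_zero]; positivity)
    (fun i => by
      rw [PiLp.sub_apply, hV.direction_apply_eq hv, hW.direction_apply_eq hw,
        ← Finset.sum_sub_distrib]
      simp_rw [hwv, ← sub_mul]
      exact abs_sum_slope_sub_mul_le θ θ' e v i)
  linarith

lemma IsGraphOf.exists_mem_near (hV : IsGraphOf e V θ) (hW : IsGraphOf e W θ')
    {x : EuclideanSpace ℝ (Fin (n + m))} (hx : x ∈ V.plane) :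
    ∃ y ∈ W.plane, ‖x - y‖ ≤ (n + m) * (n * ‖x‖ + 1) * dist θ θ' := by
  obtain ⟨w, hw, hwx⟩ := hW.exists_mem_direction
    fun j => x (e (Sum.inl j)) - W.foot (e (Sum.inl j))
  have hy : w + W.foot ∈ W.plane := AffineSubspace.vadd_mem_of_mem_direction hw W.foot_mem
  have hyx : ∀ j, (w + W.foot) (e (Sum.inl j)) = x (e (Sum.inl j)) := fun j => by
    rw [PiLp.add_apply, hwx, sub_add_cancel]
  refine ⟨w + W.foot, hy, ?_⟩
  have := norm_le_of_splitCoord e (x := x - (w + W.foot)) (B := (n * ‖x‖ + 1) * dist θ θ')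
    (by positivity)
    (fun j => by rw [PiLp.sub_apply, hyx, sub_self, abs_zero]; positivity)
    (fun i => by
      rw [PiLp.sub_apply, hV.apply_eq hx, hW.apply_eq hy, add_sub_add_comm,
        ← Finset.sum_sub_distrib]
      simp_rw [hyx, ← sub_mul]
      refine (abs_add_le _ _).trans ?_
      linarith [abs_sum_slope_sub_mul_le θ θ' e x i, abs_intercept_sub_le θ θ' i])
  linarith

/-- Split `x = a + y` along `U` and `Uᗮ`. The projection to `U'` moves `a` by at most `g * ‖a‖`. The
projection `b` of `y` satisfies `‖b‖ ^ 2 = ⟪b - w, y⟫` for `w ∈ U` near `b`, because `y` is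
orthogonal to `U`. -/
lemma norm_starProjection_sub_le {E : Type*} [NormedAddCommGroup E] [InnerProductSpace ℝ E]
    (U U' : Submodule ℝ E) [U.HasOrthogonalProjection] [U'.HasOrthogonalProjection] {g : ℝ}
    (hg : 0 ≤ g) (h : ∀ v ∈ U, ∃ w ∈ U', ‖v - w‖ ≤ g * ‖v‖)
    (h' : ∀ v ∈ U', ∃ w ∈ U, ‖v - w‖ ≤ g * ‖v‖) :
    ‖U.starProjection - U'.starProjection‖ ≤ 2 * g := by
  refine ContinuousLinearMap.opNorm_le_bound _ (by positivity) fun x => ?_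
  set a := U.starProjection x with ha
  set y := x - a with hy
  have hyU : y ∈ Uᗮ := U.sub_starProjection_mem_orthogonal x
  have haU : a ∈ U := U.starProjection_apply_mem x
  have hax : ‖a‖ ≤ ‖x‖ := U.norm_starProjection_apply_le x
  have hyx : ‖y‖ ≤ ‖x‖ := by
    have := Uᗮ.norm_starProjection_apply_le x
    rwa [Submodule.starProjection_orthogonal_val] at this
  have e1 : (U.starProjection - U'.starProjection) x =
      (a - U'.starProjection a) - U'.starProjection y := by
    rw [hy, map_sub, sub_apply]
    abel
  have h1 : ‖a - U'.starProjection a‖ ≤ g * ‖a‖ := by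
    obtain ⟨w, hw, hle⟩ := h a haU
    refine le_trans ?_ hle
    rw [Submodule.starProjection_minimal]
    exact ciInf_le ⟨0, by rintro _ ⟨z, rfl⟩; exact norm_nonneg _⟩ (⟨w, hw⟩ : U')
  have h2 : ‖U'.starProjection y‖ ≤ g * ‖y‖ := by
    set b := U'.starProjection y with hb
    have hbU : b ∈ U' := U'.starProjection_apply_mem y
    obtain ⟨w, hw, hle⟩ := h' b hbU
    have e2 : ‖b‖ * ‖b‖ = inner ℝ (b - w) y := by
      have e3 : inner ℝ b (y - b) = 0 :=
        Submodule.inner_right_of_mem_orthogonal hbU (U'.sub_starProjection_mem_orthogonal y)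
      have e4 : inner ℝ w y = 0 := Submodule.inner_right_of_mem_orthogonal hw hyU
      rw [inner_sub_left, e4, sub_zero, ← real_inner_self_eq_norm_mul_norm]
      rw [inner_sub_right] at e3
      linarith
    have e5 : ‖b‖ * ‖b‖ ≤ (g * ‖y‖) * ‖b‖ := by
      rw [e2]
      refine (real_inner_le_norm _ _).trans ?_
      calc ‖b - w‖ * ‖y‖ ≤ (g * ‖b‖) * ‖y‖ := by gcongr
        _ = _ := by ring
    rcases (norm_nonneg b).eq_or_lt with h0 | h0
    · rw [← h0]; positivity
    · exact le_of_mul_le_mul_right e5 h0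
  rw [e1]
  refine (norm_sub_le _ _).trans ?_
  have h3 : g * ‖a‖ ≤ g * ‖x‖ := by gcongr
  have h4 : g * ‖y‖ ≤ g * ‖x‖ := by gcongr
  linarith

/-- The metric on affine planes is controlled by the distance of the graph parameters. -/
lemma IsGraphOf.dist_le (hV : IsGraphOf e V θ) (hW : IsGraphOf e W θ') {R : ℝ}
    (hR : ‖V.foot‖ ≤ R) :
    dist V W ≤ (2 * (n + m) * ((n + n * R) + (n * R + 1))) * dist θ θ' := by
  have hD : 0 ≤ dist θ θ' := dist_nonneg
  have h1 : ‖V.dirProj - W.dirProj‖ ≤ 2 * ((n + m) * n * dist θ θ') :=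
    norm_starProjection_sub_le _ _ (by positivity) (fun v hv => hV.exists_direction_near hW hv)
      (fun v hv => by rw [dist_comm]; exact hW.exists_direction_near hV hv)
  obtain ⟨y, hy, hxy⟩ := hV.exists_mem_near hW V.foot_mem
  have hVf : V.dirProj V.foot = 0 :=
    (Submodule.starProjection_apply_eq_zero_iff _).2 V.foot_mem_orthogonal
  have hWf : W.dirProj y = y - W.foot := by
    have e1 : W.dirProj W.foot = 0 :=
      (Submodule.starProjection_apply_eq_zero_iff _).2 W.foot_mem_orthogonal
    have e2 : W.dirProj (y - W.foot) = y - W.foot :=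
      Submodule.starProjection_eq_self_iff.2 (AffineSubspace.vsub_mem_direction hy W.foot_mem)
    rwa [map_sub, e1, sub_zero] at e2
  -- Uses that `V.dirProj` kills `V.foot`, and that `W.foot` is `y` minus its image under
  -- `W.dirProj`.
  have e : V.foot - W.foot = (V.foot - y) - W.dirProj (V.foot - y) -
      (V.dirProj - W.dirProj) V.foot := by
    rw [map_sub, hWf, sub_apply, hVf]
    abel
  have h2 : ‖V.foot - W.foot‖ ≤ 2 * ((n + m) * (n * R + 1) * dist θ θ') +
      2 * ((n + m) * n * dist θ θ') * R := by
    rw [e]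
    have h3 : ‖W.dirProj (V.foot - y)‖ ≤ ‖V.foot - y‖ :=
      Submodule.norm_starProjection_apply_le _ _
    have h4 : ‖(V.dirProj - W.dirProj) V.foot‖ ≤ 2 * ((n + m) * n * dist θ θ') * R :=
      (ContinuousLinearMap.le_opNorm _ _).trans (by gcongr)
    have h5 : ((n : ℝ) + m) * (n * ‖V.foot‖ + 1) * dist θ θ' ≤
        (n + m) * (n * R + 1) * dist θ θ' := by gcongr
    have h6 := norm_sub_le ((V.foot - y) - W.dirProj (V.foot - y)) ((V.dirProj - W.dirProj) V.foot)
    have h7 := norm_sub_le (V.foot - y) (W.dirProj (V.foot - y))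
    linarith
  change ‖V.dirProj - W.dirProj‖ + ‖V.foot - W.foot‖ ≤ _
  linarith

lemma IsGraphOf.abs_graphDisp_le {e : Fin n ⊕ Fin m ≃ Fin (n + m)} {V : AffGrass (n + m) n}
    {θ : GraphPar n m} (h : IsGraphOf e V θ) {p q : EuclideanSpace ℝ (Fin (n + m))}
    (hq : q ∈ V.plane) (i : Fin m) :
    |graphDisp θ (splitCoord e p) i| ≤ (n + 1) * ‖p - q‖ := by
  have e1 : graphDisp θ (splitCoord e p) i = (p - q) (e (Sum.inr i)) -
      ∑ j, (θ i).1 j * (p - q) (e (Sum.inl j)) := by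
    have := h.2 q hq i
    simp only [graphDisp, splitCoord] at this ⊢
    simp only [PiLp.sub_apply, mul_sub, Finset.sum_sub_distrib]
    linarith
  have e2 : |∑ j, (θ i).1 j * (p - q) (e (Sum.inl j))| ≤ n * ‖p - q‖ := by
    refine (Finset.abs_sum_le_sum_abs _ _).trans ?_
    calc ∑ j, |(θ i).1 j * (p - q) (e (Sum.inl j))| ≤ ∑ _j : Fin n, ‖p - q‖ := by
          refine Finset.sum_le_sum fun j _ => ?_
          rw [abs_mul]
          exact (mul_le_of_le_one_left (abs_nonneg _) (h.1 i j)).trans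
            (EuclideanSpace.abs_apply_le_norm _ _)
      _ = n * ‖p - q‖ := by simp
  rw [e1]
  refine (abs_sub _ _).trans ?_
  linarith [EuclideanSpace.abs_apply_le_norm (p - q) (e (Sum.inr i))]

lemma IsGraphOf.norm_le {e : Fin n ⊕ Fin m ≃ Fin (n + m)} {V : AffGrass (n + m) n}
    {θ : GraphPar n m} (h : IsGraphOf e V θ) {r : ℝ} (hr : ‖V.foot‖ ≤ r) (hr1 : 1 ≤ r) :
    ‖θ‖ ≤ (n + 1) * r := by
  have hnr : 1 ≤ (n + 1) * r := by
    have : (0 : ℝ) ≤ n := Nat.cast_nonneg n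
    nlinarith
  refine (pi_norm_le_iff_of_nonneg (by linarith)).2 fun i => ?_
  rw [Prod.norm_def]
  refine max_le ((pi_norm_le_iff_of_nonneg (by linarith)).2 fun j => (h.1 i j).trans hnr) ?_
  have h1 := h.abs_graphDisp_le (p := 0) V.foot_mem i
  rw [zero_sub, norm_neg] at h1
  have h2 : graphDisp θ (splitCoord e 0) i = -(θ i).2 := by simp [graphDisp, splitCoord]
  rw [h2, abs_neg] at h1
  exact h1.trans (by gcongr)

lemma AffGrass.norm_foot_le {d n : ℕ} (V : AffGrass d n) {q : EuclideanSpace ℝ (Fin d)}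
    (hq : q ∈ V.plane) : ‖V.foot‖ ≤ ‖q‖ := by
  have h1 : inner ℝ (q - V.foot) V.foot = 0 := Submodule.inner_right_of_mem_orthogonal
    (AffineSubspace.vsub_mem_direction hq V.foot_mem) V.foot_mem_orthogonal
  rw [inner_sub_left, real_inner_self_eq_norm_mul_norm, sub_eq_zero] at h1
  have h2 := real_inner_le_norm q V.foot
  rw [h1] at h2
  rcases (norm_nonneg V.foot).eq_or_lt with h0 | h0
  · rw [← h0]; positivity
  · exact le_of_mul_le_mul_right h2 h0

/-- Doubling the radius passes to the open neighbourhood, which supplies a nearby point without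
discussing whether the distance is attained. -/
lemma AffGrass.exists_mem_plane_of_mem_cthickening {d n : ℕ} (V : AffGrass d n) {r : ℝ}
    (hr : 0 < r) {p : EuclideanSpace ℝ (Fin d)}
    (hp : p ∈ Metric.cthickening r (V.plane : Set (EuclideanSpace ℝ (Fin d)))) :
    ∃ q ∈ V.plane, ‖p - q‖ ≤ 2 * r := by
  have h := Metric.cthickening_subset_thickening' (δ₁ := r) (δ₂ := 2 * r) (by positivity)
    (by linarith) _ hp
  obtain ⟨q, hq, hpq⟩ := Metric.mem_thickening_iff.1 h
  exact ⟨q, hq, by rw [← dist_eq_norm]; exact hpq.le⟩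

lemma card_splitCoord_ball_le (e : Fin n ⊕ Fin m ≃ Fin (n + m)) {δ t A : ℝ} (hδ : 0 < δ)
    (hn : 0 < n) (htd : t ≤ n + m) (hA : 0 ≤ A) (P : Finset (EuclideanSpace ℝ (Fin (n + m))))
    (hP : ∀ r, δ ≤ r → ∀ x, ((P.filter fun p => dist p x ≤ r).card : ℝ) ≤ A * r ^ t)
    {r : ℝ} (hr : δ ≤ r) (x : SplitPt n m) :
    ((P.filter fun p => dist (splitCoord e p) x ≤ r).card : ℝ) ≤
      ((n + m : ℝ) ^ (n + m) * A) * r ^ t := by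
  have hr0 : 0 < r := hδ.trans_le hr
  have hN : (1 : ℝ) ≤ n + m := by
    have : (1 : ℝ) ≤ n := by exact_mod_cast hn
    linarith [(Nat.cast_nonneg m : (0 : ℝ) ≤ m)]
  let y : EuclideanSpace ℝ (Fin (n + m)) :=
    WithLp.toLp 2 fun k => Sum.elim x.1 x.2 (e.symm k)
  have h1 : P.filter (fun p => dist (splitCoord e p) x ≤ r) ⊆
      P.filter fun p => dist p y ≤ (n + m) * r := by
    intro p hp
    rw [Finset.mem_filter] at hp ⊢
    refine ⟨hp.1, ?_⟩
    have h2 := hp.2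
    rw [Prod.dist_eq, max_le_iff, dist_pi_le_iff hr0.le, dist_pi_le_iff hr0.le] at h2
    rw [dist_eq_norm]
    refine norm_le_of_splitCoord e hr0.le (fun j => ?_) (fun i => ?_)
    · have := h2.1 j
      simpa [y, splitCoord, Real.dist_eq] using this
    · have := h2.2 i
      simpa [y, splitCoord, Real.dist_eq] using this
  calc ((P.filter fun p => dist (splitCoord e p) x ≤ r).card : ℝ)
      ≤ ((P.filter fun p => dist p y ≤ (n + m) * r).card : ℝ) := by
        exact_mod_cast Finset.card_le_card h1
    _ ≤ A * ((n + m) * r) ^ t := hP _ (hr.trans (le_mul_of_one_le_left hr0.le hN)) y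
    _ = A * ((n + m : ℝ) ^ t * r ^ t) := by rw [mul_rpow (by positivity) hr0.le]
    _ ≤ A * ((n + m : ℝ) ^ (n + m) * r ^ t) := by
        gcongr
        rw [← rpow_natCast]
        exact rpow_le_rpow_of_exponent_le hN (by push_cast; exact htd)
    _ = _ := by ring

/-! ### The incidence bound for planes -/

open Classical in
/-- Incidence bound for finite sets of points and affine planes. -/
lemma exists_incidence_card_le (n m : ℕ) (hn : 0 < n) {C ε t : ℝ} (hC : 1 ≤ C) (hε : 0 < ε)
    (hmt : m < t) (htd : t ≤ n + m) : ∃ K : ℝ, 0 ≤ K ∧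
    ∀ C_F : ℝ, 1 ≤ C_F → ∀ δ : ℝ, 0 < δ → δ < 1 →
    ∀ (P : Finset (EuclideanSpace ℝ (Fin (n + m)))) (𝒱 : Finset (AffGrass (n + m) n)),
      (P : Set (EuclideanSpace ℝ (Fin (n + m)))) ⊆ Metric.closedBall 0 1 →
      IsDeltaSeparated δ (P : Set (EuclideanSpace ℝ (Fin (n + m)))) →
      IsDeltaSet δ t C_F (P : Set (EuclideanSpace ℝ (Fin (n + m)))) →
      IsDeltaSeparated δ (𝒱 : Set (AffGrass (n + m) n)) →
      ∑ V ∈ 𝒱, ((P.filter fun p => p ∈ Metric.cthickening (C * δ)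
          (V.plane : Set (EuclideanSpace ℝ (Fin (n + m))))).card : ℝ) ≤
        K * δ ^ (-ε) * C_F * P.card * (𝒱.card : ℝ) ^ ((n : ℝ) / (2 * n + m - t)) *
          δ ^ ((n : ℝ) * (t + 1 - (n + m)) * m / (2 * n + m - t)) := by
  have hn1 : (1 : ℝ) ≤ n := by exact_mod_cast hn
  have hm0 : (0 : ℝ) ≤ m := Nat.cast_nonneg m
  have ht0 : 0 < t := by linarith
  set r₀ : ℝ := 1 + 2 * C with hr₀
  have hr₀1 : 1 ≤ r₀ := by linarith
  set R : ℝ := (n + 1) * r₀ with hR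
  have hR1 : 1 ≤ R := by rw [hR]; nlinarith
  set Λ : ℝ := 2 * (n + m) * ((n + n * r₀) + (n * r₀ + 1)) with hΛ
  have hΛ1 : 1 ≤ Λ := by
    have h1 : (1 : ℝ) ≤ 2 * (n + m) := by linarith
    have h2 : (1 : ℝ) ≤ (n + n * r₀) + (n * r₀ + 1) := by nlinarith
    exact one_le_mul_of_one_le_of_one_le h1 h2
  obtain ⟨K, hK, h⟩ := exists_sum_card_le n m hn (M := (n + 1) * (2 * C)) (c := Λ⁻¹) (R := R)
    (ε := ε) (t := t) (by positivity) (inv_le_one_of_one_le₀ hΛ1) hR1 hε hmt.le htd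
  set G : ℝ := (n + m : ℝ) ^ (n + m) * (3 ^ (n + m) * 2 ^ (n + m)) with hG
  have hG1 : 1 ≤ G := by
    have h1 : (1 : ℝ) ≤ (n + m : ℝ) ^ (n + m) := one_le_pow₀ (by linarith)
    have h2 : (1 : ℝ) ≤ 3 ^ (n + m) := one_le_pow₀ (by norm_num)
    have h3 : (1 : ℝ) ≤ 2 ^ (n + m) := one_le_pow₀ (by norm_num)
    exact one_le_mul_of_one_le_of_one_le h1 (one_le_mul_of_one_le_of_one_le h2 h3)
  set E : ℕ := Fintype.card (Fin n ⊕ Fin m ≃ Fin (n + m)) with hE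
  refine ⟨E * (K * G), by positivity, ?_⟩
  intro C_F hC_F δ hδ hδ1 P 𝒱 hPsub hPsep hPset h𝒱
  have hCδ : 0 < C * δ := by positivity
  have hD : 0 < 2 * n + m - t := by linarith
  rcases P.eq_empty_or_nonempty with rfl | hPne
  · simp
  have hPc : (0 : ℝ) < P.card := by exact_mod_cast hPne.card_pos
  have hFr := fun r hr x => card_ball_le_of_isDeltaSet hδ ht0 (by push_cast; exact htd) hC_F P
    hPsep hPset (r := r) hr x
  choose e θ hθ using fun V : AffGrass (n + m) n => exists_isGraphOf V
  -- Planes without incidences contribute nothing; the others pass near the unit ball, so their feet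
  -- are bounded, as the comparison of metrics and the bound on parameters require.
  set 𝒱' := 𝒱.filter fun V => ∃ p ∈ P, p ∈ Metric.cthickening (C * δ)
    (V.plane : Set (EuclideanSpace ℝ (Fin (n + m)))) with h𝒱'
  have hfoot : ∀ V ∈ 𝒱', ‖V.foot‖ ≤ r₀ := by
    intro V hV
    obtain ⟨p, hp, hpV⟩ := (Finset.mem_filter.1 hV).2
    obtain ⟨q, hq, hpq⟩ := V.exists_mem_plane_of_mem_cthickening hCδ hpV
    have h1 : ‖p‖ ≤ 1 := by simpa using hPsub hp
    have h2 := norm_sub_le p (p - q)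
    rw [sub_sub_cancel] at h2
    have h3 : C * δ ≤ C := mul_le_of_le_one_right (by linarith) hδ1.le
    linarith [V.norm_foot_le hq]
  have hsum : ∑ V ∈ 𝒱, ((P.filter fun p => p ∈ Metric.cthickening (C * δ)
      (V.plane : Set (EuclideanSpace ℝ (Fin (n + m))))).card : ℝ) =
      ∑ f : Fin n ⊕ Fin m ≃ Fin (n + m), ∑ V ∈ 𝒱'.filter fun V => e V = f,
        ((P.filter fun p => p ∈ Metric.cthickening (C * δ)
          (V.plane : Set (EuclideanSpace ℝ (Fin (n + m))))).card : ℝ) := by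
    rw [Finset.sum_fiberwise, h𝒱', Finset.sum_filter_of_ne]
    intro V _ hV
    have h1 : (P.filter fun p => p ∈ Metric.cthickening (C * δ)
        (V.plane : Set (EuclideanSpace ℝ (Fin (n + m))))).card ≠ 0 := by exact_mod_cast hV
    obtain ⟨p, hp⟩ := Finset.card_ne_zero.1 h1
    exact ⟨p, (Finset.mem_filter.1 hp).1, (Finset.mem_filter.1 hp).2⟩
  have hchart : ∀ f : Fin n ⊕ Fin m ≃ Fin (n + m), ∑ V ∈ 𝒱'.filter fun V => e V = f,
        ((P.filter fun p => p ∈ Metric.cthickening (C * δ)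
          (V.plane : Set (EuclideanSpace ℝ (Fin (n + m))))).card : ℝ) ≤
      K * δ ^ (-ε) * (G * (C_F * P.card)) * (𝒱.card : ℝ) ^ ((n : ℝ) / (2 * n + m - t)) *
          δ ^ ((n : ℝ) * (t + 1 - (n + m)) * m / (2 * n + m - t)) := by
    intro f
    set 𝒲 := 𝒱'.filter fun V => e V = f with h𝒲
    have h𝒲V : ∀ V ∈ 𝒲, V ∈ 𝒱' ∧ IsGraphOf f V (θ V) := by
      intro V hV
      obtain ⟨h1, h2⟩ := Finset.mem_filter.1 hV
      exact ⟨h1, h2 ▸ hθ V⟩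
    have hsub : 𝒲 ⊆ 𝒱 := (Finset.filter_subset _ _).trans (Finset.filter_subset _ _)
    have hF : (P.card : ℝ) ≤ G * (C_F * P.card) := by
      have : (1 : ℝ) ≤ G * C_F := one_le_mul_of_one_le_of_one_le hG1 hC_F
      nlinarith
    have key := h P (splitCoord f) 𝒲 θ δ (G * (C_F * P.card)) hδ hδ1 (by positivity) hF
      (fun r hr x => by
        refine (card_splitCoord_ball_le f hδ hn htd (by positivity) P hFr hr x).trans
          (le_of_eq ?_)
        rw [hG]
        ring)
      (fun p hp => by
        refine (pi_norm_le_iff_of_nonneg zero_le_one).2 fun j => ?_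
        have h1 : ‖p‖ ≤ 1 := by simpa using hPsub hp
        exact (EuclideanSpace.abs_apply_le_norm p _).trans h1)
      (fun V hV => (h𝒲V V hV).2.1)
      (fun V hV => (h𝒲V V hV).2.norm_le (hfoot V (h𝒲V V hV).1) hr₀1)
      (fun V hV W hW hVW => by
        have h1 := (h𝒲V V hV).2.dist_le (h𝒲V W hW).2 (hfoot V (h𝒲V V hV).1)
        have h2 := h𝒱 (hsub hV) (hsub hW) hVW
        exact (inv_mul_le_iff₀ (by positivity)).2 (h2.trans h1))
    have hcard : (𝒲.card : ℝ) ≤ 𝒱.card := by exact_mod_cast Finset.card_le_card hsub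
    calc _ ≤ ∑ V ∈ 𝒲, ((P.filter fun p =>
            ∀ i, |graphDisp (θ V) (splitCoord f p) i| ≤ (n + 1) * (2 * C) * δ).card : ℝ) := by
          refine Finset.sum_le_sum fun V hV => ?_
          have : P.filter (fun p => p ∈ Metric.cthickening (C * δ)
              (V.plane : Set (EuclideanSpace ℝ (Fin (n + m))))) ⊆ P.filter fun p =>
              ∀ i, |graphDisp (θ V) (splitCoord f p) i| ≤ (n + 1) * (2 * C) * δ := by
            intro p hp
            rw [Finset.mem_filter] at hp ⊢
            refine ⟨hp.1, fun i => ?_⟩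
            obtain ⟨q, hq, hpq⟩ := V.exists_mem_plane_of_mem_cthickening hCδ hp.2
            refine ((h𝒲V V hV).2.abs_graphDisp_le hq i).trans ?_
            calc ((n : ℝ) + 1) * ‖p - q‖ ≤ (n + 1) * (2 * (C * δ)) := by gcongr
              _ = _ := by ring
          exact_mod_cast Finset.card_le_card this
      _ ≤ _ := key
      _ ≤ _ := by gcongr
  rw [hsum]
  refine (Finset.sum_le_sum fun f _ => hchart f).trans (le_of_eq ?_)
  rw [Finset.sum_const, nsmul_eq_mul, Finset.card_univ, ← hE]
  ring

end GraphCharts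

lemma finite_of_isDeltaSeparated {d : ℕ} {δ : ℝ} (hδ : 0 < δ)
    {P : Set (EuclideanSpace ℝ (Fin d))} (hP : P ⊆ Metric.closedBall 0 1)
    (hsep : IsDeltaSeparated δ P) : P.Finite := by
  obtain ⟨N, hN⟩ := exists_nat_ge (((2 * 1 + δ) / δ) ^ d)
  exact Set.finite_of_encard_le_coe
    (encard_le_of_isDeltaSeparated hδ zero_le_one hN P 0 hsep fun p hp => hP hp)

open Classical in
lemma encard_incidences_coe {d n : ℕ} (r : ℝ) (P : Finset (EuclideanSpace ℝ (Fin d)))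
    (𝒱 : Finset (AffGrass d n)) :
    ((incidences r (P : Set (EuclideanSpace ℝ (Fin d))) (𝒱 : Set (AffGrass d n))).encard : ℝ≥0∞) =
      ENNReal.ofReal (∑ V ∈ 𝒱, ((P.filter fun p => p ∈ Metric.cthickening r
          (V.plane : Set (EuclideanSpace ℝ (Fin d)))).card : ℝ)) := by
  have h : incidences r (P : Set (EuclideanSpace ℝ (Fin d))) (𝒱 : Set (AffGrass d n)) =
      (((P ×ˢ 𝒱).filter fun x => x.1 ∈ Metric.cthickening r
        (x.2.plane : Set (EuclideanSpace ℝ (Fin d))) : Finset _) : Set _) := by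
    ext x
    simp [incidences, and_assoc]
  rw [h, Set.encard_coe_eq_coe_finsetCard, ENat.toENNReal_coe, ← Nat.cast_sum,
    ENNReal.ofReal_natCast, Finset.card_filter, Finset.sum_product_right]
  simp_rw [← Finset.card_filter]

theorem theorem1p6 (d : ℕ) (C ε t : ℝ) (hC : 1 ≤ C) (hε : 0 < ε) :
    ∃ K : ℝ, 0 < K ∧
      ∀ n : ℕ, 0 < n → n < d → (d : ℝ) - n < t → t ≤ d →
      ∀ C_F : ℝ, 1 ≤ C_F →
      ∀ δ : ℝ, 0 < δ → δ < 1 →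
      ∀ (P : Set (EuclideanSpace ℝ (Fin d))) (𝒱 : Set (AffGrass d n)),
        P ⊆ Metric.closedBall 0 1 → IsDeltaSeparated δ P → IsDeltaSet δ t C_F P →
        IsDeltaSeparated δ 𝒱 →
        ((incidences (C * δ) P 𝒱).encard : ℝ≥0∞) ≤
          ENNReal.ofReal K * ENNReal.ofReal (δ ^ (-ε)) * ENNReal.ofReal C_F *
            (P.encard : ℝ≥0∞) * (𝒱.encard : ℝ≥0∞) ^ ((n : ℝ) / (d + n - t)) *
            ENNReal.ofReal (δ ^ ((n : ℝ) * (t + 1 - d) * (d - n) / (d + n - t))) := by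
  classical
  have hfix : ∀ n : ℕ, ∃ K : ℝ, 0 ≤ K ∧ (0 < n → n < d → (d : ℝ) - n < t → t ≤ d →
      ∀ C_F : ℝ, 1 ≤ C_F → ∀ δ : ℝ, 0 < δ → δ < 1 →
      ∀ (P : Finset (EuclideanSpace ℝ (Fin d))) (𝒱 : Finset (AffGrass d n)),
        (P : Set (EuclideanSpace ℝ (Fin d))) ⊆ Metric.closedBall 0 1 →
        IsDeltaSeparated δ (P : Set (EuclideanSpace ℝ (Fin d))) →
        IsDeltaSet δ t C_F (P : Set (EuclideanSpace ℝ (Fin d))) →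
        IsDeltaSeparated δ (𝒱 : Set (AffGrass d n)) →
        ∑ V ∈ 𝒱, ((P.filter fun p => p ∈ Metric.cthickening (C * δ)
            (V.plane : Set (EuclideanSpace ℝ (Fin d)))).card : ℝ) ≤
          K * δ ^ (-ε) * C_F * P.card * (𝒱.card : ℝ) ^ ((n : ℝ) / (d + n - t)) *
            δ ^ ((n : ℝ) * (t + 1 - d) * (d - n) / (d + n - t))) := by
    intro n
    by_cases hyp : 0 < n ∧ n < d ∧ (d : ℝ) - n < t ∧ t ≤ d
    · obtain ⟨hn, hnd, hmt, htd⟩ := hyp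
      obtain ⟨m, rfl⟩ := Nat.exists_eq_add_of_le hnd.le
      push_cast at hmt htd
      obtain ⟨K, hK, h⟩ := exists_incidence_card_le n m hn hC hε (by linarith : (m : ℝ) < t) htd
      refine ⟨K, hK, fun _ _ _ _ C_F hC_F δ hδ hδ1 P 𝒱 h1 h2 h3 h4 => ?_⟩
      have := h C_F hC_F δ hδ hδ1 P 𝒱 h1 h2 h3 h4
      convert this using 4 <;> push_cast <;> ring
    -- For inadmissible `n` any constant serves. Summing the constants over `n < d` then gives one
    -- that does not depend on `n`.
    · exact ⟨0, le_rfl, fun h1 h2 h3 h4 => absurd ⟨h1, h2, h3, h4⟩ hyp⟩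
  choose K hK0 hK using hfix
  have hsum : 0 ≤ ∑ k ∈ Finset.range d, K k := Finset.sum_nonneg fun k _ => hK0 k
  refine ⟨∑ k ∈ Finset.range d, K k + 1, by positivity, ?_⟩
  intro n hn hnd hmt htd C_F hC_F δ hδ hδ1 P 𝒱 hPsub hPsep hPset h𝒱
  have hn0 : (0 : ℝ) < n := by exact_mod_cast hn
  have hexp : 0 < (n : ℝ) / (d + n - t) := div_pos hn0 (by linarith)
  have hKn : K n ≤ ∑ k ∈ Finset.range d, K k + 1 := by
    linarith [Finset.single_le_sum (fun k _ => hK0 k) (Finset.mem_range.2 hnd)]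
  have hPfin := finite_of_isDeltaSeparated hδ hPsub hPsep
  lift P to Finset (EuclideanSpace ℝ (Fin d)) using hPfin
  rcases 𝒱.finite_or_infinite with hfin | hinf
  · lift 𝒱 to Finset (AffGrass d n) using hfin
    have key := hK n hn hnd hmt htd C_F hC_F δ hδ hδ1 P 𝒱 hPsub hPsep hPset h𝒱
    rw [encard_incidences_coe, Set.encard_coe_eq_coe_finsetCard, Set.encard_coe_eq_coe_finsetCard,
      ENat.toENNReal_coe, ENat.toENNReal_coe, ← ENNReal.ofReal_natCast P.card,
      ← ENNReal.ofReal_natCast 𝒱.card, ENNReal.ofReal_rpow_of_nonneg (by positivity) hexp.le,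
      ← ENNReal.ofReal_mul (by positivity), ← ENNReal.ofReal_mul (by positivity),
      ← ENNReal.ofReal_mul (by positivity), ← ENNReal.ofReal_mul (by positivity),
      ← ENNReal.ofReal_mul (by positivity)]
    refine ENNReal.ofReal_le_ofReal (key.trans ?_)
    gcongr
  -- For infinite `𝒱` the right side is infinite unless `P` is empty; in that case there are no
  -- incidences and the bound reads `0 ≤ 0`.
  · rcases P.eq_empty_or_nonempty with rfl | hPne
    · have : incidences (C * δ) ((∅ : Finset (EuclideanSpace ℝ (Fin d))) :
          Set (EuclideanSpace ℝ (Fin d))) 𝒱 = ∅ := by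
        ext x
        simp [incidences]
      rw [this]
      simp
    · rw [hinf.encard_eq, ENat.toENNReal_top, ENNReal.top_rpow_of_pos hexp, ENNReal.mul_top,
        ENNReal.top_mul]
      · exact le_top
      · exact (ENNReal.ofReal_pos.2 (by positivity)).ne'
      · have h1 : ((P : Set (EuclideanSpace ℝ (Fin d))).encard : ℝ≥0∞) ≠ 0 := by
          rw [Set.encard_coe_eq_coe_finsetCard, ENat.toENNReal_coe]
          exact_mod_cast hPne.card_pos.ne'
        refine mul_ne_zero (mul_ne_zero (mul_ne_zero ?_ ?_) ?_) h1 <;>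
        exact (ENNReal.ofReal_pos.2 (by positivity)).ne'
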